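/- For $n\ge 3$ let $D_n=\langle a,b\mid a^2=b^n=(ab)^2=e\rangle$ be the dihedral group of order $2n$, with the reflections $a_i=ab^i$ ($0\le i\le n-1$) and the nontrivial rotations $b_j=b^j$ ($1\le j\le n-1$). Let $D$ be a diagram of an oriented link. A $D_n$-coloring of $D$ is a map $\Gamma$ from the arcs of $D$ to $D_n$ such that at each crossing, with over arc $x$, incoming under arc $y$ and outgoing under arc $z$, one has $\Gamma(x)\Gamma(z)=\Gamma(y)\Gamma(x)$ if the crossing is positive and $\Gamma(z)\Gamma(x)=\Gamma(x)\Gamma(y)$ if it is negative. It is two-tone if $e$ is not among its values and its values include both some $a_i$ and some $b_j$. Proposition. Let $L$ be an oriented link in $S^3$ with at least two components. Suppose that $L$ has a component $\ell_0$ that is trivial (i.e. $\ell_0$, regarded as a knot by itself, is the unknot) and that the linking number $lk(\ell_0,\ell)$ is even for every other component $\ell$ of $L$. Then, for every diagram $D$ of $L$ and every odd $n\ge 3$, there is a two-tone $D_n$-coloring of $D$ that colors every arc of $\ell_0$ by some reflection $a_i$ and every arc of the other components by some nontrivial rotation $b_j$. (Links are given by oriented link diagrams in the sphere, two diagrams presenting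 the same link when they are related by Reidemeister moves; $\ell_0$ is trivial when the diagram obtained from $D$ by deleting the other components is related by Reidemeister moves to the circle without crossings; $lk(\ell_0,\ell)$ is the sum of the signs of the crossings of $D$ at which $\ell$ passes under $\ell_0$.) -/

import Mathlib

/-- Every point of `S` returns to `S` along its `σ`-orbit. -/
theorem Equiv.Perm.exists_return {α : Type} [Finite α] (σ : Equiv.Perm α) (S : Set α) (x : S) :
    ∃ k : ℕ, (σ ^ (k + 1)) (x : α) ∈ S := by
  refine ⟨orderOf σ - 1, ?_⟩
  have h : orderOf σ - 1 + 1 = orderOf σ := Nat.sub_add_cancel (orderOf_pos σ)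
  rw [h, pow_orderOf_eq_one]
  exact x.2

open Classical in
/-- One less than the first positive time at which the `σ`-orbit of `x ∈ S` is back in `S`. -/
noncomputable def Equiv.Perm.returnTime {α : Type} [Finite α] (σ : Equiv.Perm α) (S : Set α)
    (x : S) : ℕ :=
  Nat.find (σ.exists_return S x)

open Classical in
theorem Equiv.Perm.returnTime_spec {α : Type} [Finite α] (σ : Equiv.Perm α) (S : Set α) (x : S) :
    (σ ^ (σ.returnTime S x + 1)) (x : α) ∈ S :=
  Nat.find_spec (σ.exists_return S x)

open Classical in
theorem Equiv.Perm.returnTime_min {α : Type} [Finite α] (σ : Equiv.Perm α) (S : Set α) (x : S)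
    {k : ℕ} (h : (σ ^ (k + 1)) (x : α) ∈ S) : σ.returnTime S x ≤ k :=
  Nat.find_min' (σ.exists_return S x) h

/-- The first return map of `σ` to `S`, as a function: a point of `S` is moved along its `σ`-orbit
until it meets `S` again. -/
noncomputable def Equiv.Perm.returnMap {α : Type} [Finite α] (σ : Equiv.Perm α) (S : Set α)
    (x : S) : S :=
  ⟨(σ ^ (σ.returnTime S x + 1)) (x : α), σ.returnTime_spec S x⟩

theorem Equiv.Perm.returnMap_injective {α : Type} [Finite α] (σ : Equiv.Perm α) (S : Set α) :
    Function.Injective (σ.returnMap S) := by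
  have key : ∀ x y : S, σ.returnTime S x ≤ σ.returnTime S y →
      σ.returnMap S x = σ.returnMap S y → x = y := by
    intro x y hle h
    obtain ⟨m, hm⟩ := Nat.exists_eq_add_of_le hle
    have h1 : (σ ^ (σ.returnTime S x + 1)) (x : α) = (σ ^ (σ.returnTime S y + 1)) (y : α) :=
      congrArg Subtype.val h
    have h2 : σ.returnTime S y + 1 = (σ.returnTime S x + 1) + m := by omega
    rw [h2, pow_add σ (σ.returnTime S x + 1) m, Equiv.Perm.mul_apply] at h1
    have h3 : (x : α) = (σ ^ m) (y : α) := (σ ^ (σ.returnTime S x + 1)).injective h1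
    rcases m with _ | m
    · exact Subtype.ext (by simpa using h3)
    · have h4 : σ.returnTime S y ≤ m := σ.returnTime_min S y (h3 ▸ x.2)
      omega
  intro x y h
  rcases le_total (σ.returnTime S x) (σ.returnTime S y) with hle | hle
  · exact key x y hle h
  · exact (key y x hle h.symm).symm

/-- The first return map of `σ` to `S`, as a permutation of `S`. -/
noncomputable def Equiv.Perm.firstReturn {α : Type} [Finite α] (σ : Equiv.Perm α) (S : Set α) :
    Equiv.Perm S :=
  Equiv.ofBijective (σ.returnMap S)
    (Finite.injective_iff_bijective.mp (σ.returnMap_injective S))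

/-- An oriented (signed) Gauss diagram of a link. The two passages through a crossing `c` are
`(c, true)` (over) and `(c, false)` (under). Following the orientation, the passage `p` is
succeeded by the passage `next p`; so the edges of the diagram correspond to the passages, the
passage `p` to the edge that leaves it. Closed components that meet no crossing at all are listed
in `Circle`. A link diagram in the sphere is a Gauss diagram satisfying `GaussDiagram.Planar`. -/
structure GaussDiagram where
  Crossing : Type
  [finiteCrossing : Finite Crossing]
  /-- `1` for a positive crossing and `-1` for a negative one. -/
  sign : Crossing → ℤˣ
  next : Equiv.Perm (Crossing × Bool)
  Circle : Type
  [finiteCircle : Finite Circle]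

namespace GaussDiagram

attribute [instance] finiteCrossing finiteCircle

/-- The diagram of one circle without crossings. -/
def unknot : GaussDiagram where
  Crossing := Empty
  sign := Empty.elim
  next := Equiv.refl _
  Circle := Unit

/-! ### Planarity -/

/-- A side of an edge, equivalently an edge with a direction of travel: `(p, true)` leaves the
passage `p` along the orientation and `(p, false)` leaves it against the orientation. The dart
stands for the side of the edge on the left of the traveller. -/
abbrev Dart (D : GaussDiagram) : Type := (D.Crossing × Bool) × Bool

/-- Travel along an edge: the passage at which one arrives, and the direction of travel. -/
def travel (D : GaussDiagram) : Equiv.Perm D.Dart where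
  toFun x := (if x.2 = true then D.next x.1 else D.next.symm x.1, x.2)
  invFun x := (if x.2 = true then D.next.symm x.1 else D.next x.1, x.2)
  left_inv := by rintro ⟨p, _ | _⟩ <;> simp
  right_inv := by rintro ⟨p, _ | _⟩ <;> simp

/-- The passage at which a dart arrives. -/
def target (D : GaussDiagram) (x : D.Dart) : D.Crossing × Bool := (D.travel x).1

/-- Turn left at a crossing. At a positive crossing the under strand passes from the right of the
over strand to its left, so a traveller along the over strand who turns left keeps his direction
relative to the orientations, and a traveller along the under strand reverses it; at a negative
crossing it is the other way round. -/
def turnLeft (D : GaussDiagram) : Equiv.Perm D.Dart where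
  toFun x := ((x.1.1, !x.1.2), if (x.1.2 = true ↔ D.sign x.1.1 = 1) then x.2 else !x.2)
  invFun x := ((x.1.1, !x.1.2), if (x.1.2 = false ↔ D.sign x.1.1 = 1) then x.2 else !x.2)
  left_inv := by
    rintro ⟨⟨c, _ | _⟩, d⟩ <;> by_cases h : D.sign c = 1 <;> simp [h]
  right_inv := by
    rintro ⟨⟨c, _ | _⟩, d⟩ <;> by_cases h : D.sign c = 1 <;> simp [h]

/-- Walk once along the boundary of the region on the left. -/
def face (D : GaussDiagram) : Equiv.Perm D.Dart := D.turnLeft * D.travel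

/-- The regions (faces) of the closed surface obtained by gluing discs to the 4-valent graph of
the diagram along its boundary walks. -/
abbrev Face (D : GaussDiagram) : Type := Quotient (Equiv.Perm.SameCycle.setoid D.face)

/-- The connected components of the 4-valent graph of the diagram. -/
abbrev Piece (D : GaussDiagram) : Type :=
  Quot (fun c c' : D.Crossing => ∃ o : Bool, (D.next (c, o)).1 = c')

/-- The diagram lies in the sphere: Euler's formula `V - E + F = 2 C`, where
`E = 2 V` because the graph is 4-valent. -/
def Planar (D : GaussDiagram) : Prop :=
  Nat.card D.Face = Nat.card D.Crossing + 2 * Nat.card D.Piece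

/-! ### Components and sublinks -/

/-- The components of the link: the orbits of `next`, and the circles without crossings. -/
abbrev Component (D : GaussDiagram) : Type :=
  Quotient (Equiv.Perm.SameCycle.setoid D.next) ⊕ D.Circle

/-- The component to which a passage (or the edge that leaves it) belongs. -/
def componentOf (D : GaussDiagram) (p : D.Crossing × Bool) : D.Component :=
  Sum.inl (Quotient.mk (Equiv.Perm.SameCycle.setoid D.next) p)

/-- Keep only the components in `K` and only the crossings in `S` (all of whose passages are
supposed to lie on components in `K`). The passages through other crossings are forgotten; a
component that is kept but loses all its crossings becomes a circle without crossings. -/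
noncomputable def restrict (D : GaussDiagram) (K : Set D.Component) (S : Set D.Crossing) :
    GaussDiagram where
  Crossing := {c : D.Crossing // c ∈ S}
  sign c := D.sign c
  next := (Equiv.prodSubtypeFstEquivSubtypeProd (p := fun c : D.Crossing => c ∈ S)).permCongr
    (D.next.firstReturn {p | p.1 ∈ S})
  Circle := {j : D.Component // j ∈ K ∧ ∀ p : D.Crossing × Bool, p.1 ∈ S → D.componentOf p ≠ j}

/-- The diagram of the sublink formed by the components in `K`: the other components are deleted,
together with all crossings in which they take part. -/
noncomputable def sublink (D : GaussDiagram) (K : Set D.Component) : GaussDiagram :=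
  D.restrict K {c | ∀ o : Bool, D.componentOf (c, o) ∈ K}

/-- Forget the crossings in `S`, keeping all components. -/
noncomputable def eraseCrossings (D : GaussDiagram) (S : Set D.Crossing) : GaussDiagram :=
  D.restrict Set.univ Sᶜ

/-! ### Reidemeister moves -/

open Classical in
/-- Exchange the order of the two passages at the ends of each of the edges of `x`, `y`, `z`. -/
noncomputable def exchange (D : GaussDiagram) (x y z : D.Dart) : GaussDiagram where
  Crossing := D.Crossing
  sign := D.sign
  next :=
    let τ := Equiv.swap x.1 (D.target x) * Equiv.swap y.1 (D.target y) *
      Equiv.swap z.1 (D.target z)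
    τ * D.next * τ⁻¹
  Circle := D.Circle

/-- Relabelling of a diagram, and the three Reidemeister moves (the first two in the direction
that removes crossings). -/
inductive Move : GaussDiagram → GaussDiagram → Prop
  /-- Relabelling. -/
  | iso (D D' : GaussDiagram) (f : D.Crossing ≃ D'.Crossing) (_ : D.Circle ≃ D'.Circle)
      (hsign : ∀ c, D'.sign (f c) = D.sign c)
      (hnext : ∀ p, D'.next (Prod.map f id p) = Prod.map f id (D.next p)) : Move D D'
  /-- Removing the crossing of a monogon. -/
  | r1 (D : GaussDiagram) (x : D.Dart) (h : D.face x = x) :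
      Move D (D.eraseCrossings {x.1.1})
  /-- Removing the two crossings of a bigon, one side of which lies over the other. -/
  | r2 (D : GaussDiagram) (x : D.Dart) (h : D.face (D.face x) = x)
      (hne : x.1.1 ≠ (D.target x).1) (hover : x.1.2 = true ∧ (D.target x).2 = true) :
      Move D (D.eraseCrossings {x.1.1, (D.target x).1})
  /-- The move across a triangle with three distinct crossings, one side of which (that of `x`)
  passes over the lines that contain the other two. -/
  | r3 (D : GaussDiagram) (x y z : D.Dart) (hxy : D.face x = y) (hyz : D.face y = z)
      (hzx : D.face z = x)
      (hne : x.1.1 ≠ y.1.1 ∧ y.1.1 ≠ z.1.1 ∧ z.1.1 ≠ x.1.1)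
      (hover : x.1.2 = true ∧ (D.target x).2 = true) :
      Move D (D.exchange x y z)

/-- Two diagrams present the same oriented link: they are connected by a finite sequence of
Reidemeister moves and inverse moves through diagrams in the sphere. -/
def SameLink (D D' : GaussDiagram) : Prop :=
  Relation.EqvGen (fun A B : GaussDiagram => A.Planar ∧ B.Planar ∧ Move A B) D D'

/-- The component `i` is a trivial (unknotted) component: as a knot by itself it is the unknot. -/
def IsTrivialComponent (D : GaussDiagram) (i : D.Component) : Prop :=
  SameLink (D.sublink {i}) unknot

/-- The linking number of two different components `i` and `j`: the sum of the signs of the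
crossings at which `j` passes under `i`. -/
noncomputable def linkingNumber (D : GaussDiagram) (i j : D.Component) : ℤ :=
  ∑ᶠ c ∈ {c : D.Crossing | D.componentOf (c, true) = i ∧ D.componentOf (c, false) = j},
    (D.sign c : ℤ)

/-! ### Arcs and colorings -/

/-- The arcs of the diagram: edges are joined at over-passages (and cut at under-passages only);
a circle without crossings is an arc, too. -/
abbrev Arc (D : GaussDiagram) : Type :=
  Quot (fun p q : D.Crossing × Bool => D.next p = q ∧ q.2 = true) ⊕ D.Circle

/-- The arc containing the edge that leaves the passage `p`. -/
def arcAfter (D : GaussDiagram) (p : D.Crossing × Bool) : D.Arc := Sum.inl (Quot.mk _ p)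

/-- The arc containing the edge that enters the passage `p`. -/
def arcBefore (D : GaussDiagram) (p : D.Crossing × Bool) : D.Arc := D.arcAfter (D.next.symm p)

/-- The over arc at a crossing. -/
def overArc (D : GaussDiagram) (c : D.Crossing) : D.Arc := D.arcAfter (c, true)

theorem overArc_eq_arcBefore (D : GaussDiagram) (c : D.Crossing) :
    D.overArc c = D.arcBefore (c, true) :=
  congrArg Sum.inl (Quot.sound ⟨by simp, rfl⟩).symm

/-- The component to which an arc belongs. -/
def Arc.component {D : GaussDiagram} : D.Arc → D.Component
  | Sum.inl a => Quot.lift D.componentOf (by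
      rintro p q ⟨rfl, -⟩
      exact congrArg Sum.inl (Quotient.sound
        (Equiv.Perm.sameCycle_apply_right.mpr (Equiv.Perm.SameCycle.refl D.next p)))) a
  | Sum.inr t => Sum.inr t

/-- A `D_n`-coloring: with `x` the over arc, `y` the incoming and `z` the outgoing under arc,
`Γ x * Γ z = Γ y * Γ x` at each positive crossing and `Γ z * Γ x = Γ x * Γ y` at each negative
one. In `DihedralGroup n`, the reflections `a bⁱ` are the `sr i` and the rotations `bʲ` the
`r j`. -/
def IsColoring (D : GaussDiagram) {n : ℕ} (Γ : D.Arc → DihedralGroup n) : Prop :=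
  ∀ c : D.Crossing,
    (D.sign c = 1 → Γ (D.overArc c) * Γ (D.arcAfter (c, false)) =
      Γ (D.arcBefore (c, false)) * Γ (D.overArc c)) ∧
    (D.sign c = -1 → Γ (D.arcAfter (c, false)) * Γ (D.overArc c) =
      Γ (D.overArc c) * Γ (D.arcBefore (c, false)))

/-- The reflections `a₀, …, aₙ₋₁`. -/
def reflections (n : ℕ) : Set (DihedralGroup n) := Set.range DihedralGroup.sr

/-- The nontrivial rotations `b₁, …, bₙ₋₁`. -/
def rotations (n : ℕ) : Set (DihedralGroup n) := DihedralGroup.r '' {j : ZMod n | j ≠ 0}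

/-- A coloring is two-tone if it avoids the trivial element and uses both reflections and
rotations. -/
def IsTwoTone {D : GaussDiagram} {n : ℕ} (Γ : D.Arc → DihedralGroup n) : Prop :=
  1 ∉ Set.range Γ ∧ (Set.range Γ ∩ reflections n).Nonempty ∧
    (Set.range Γ ∩ rotations n).Nonempty

end GaussDiagram

/-!
The colouring puts rotations `b^{±1}` on the components other than `ℓ₀` and reflections `a b^{f}` on
`ℓ₀`. A rotation is inverted when its strand passes under `ℓ₀` and is otherwise unchanged, so the
signs close up along `ℓ` exactly when `lk(ℓ₀, ℓ)` is even (`exists_rotation_sign`). The exponents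
`f` along `ℓ₀` then have to satisfy an inhomogeneous version of the Fox relations of the knot `ℓ₀`:
at a self-crossing the two under exponents add up to twice the over exponent, and at a passage under
another component the exponent jumps by `± 2`.

This linear system over `ℤ/n` is solvable (`exists_reflections`) for two reasons. First, the
homogeneous system has only the constant solutions: this property (`FoxRigid`) of a diagram is
invariant under the Reidemeister moves (`Move.foxRigid_iff`) and holds for the circle without
crossings. So the image of the system is as large as a hyperplane, and it lies in one: the
relations, taken with suitable signs, add up to zero. Secondly, the right-hand side lies in
this hyperplane.

The signs come from planarity. A mod 2 cycle of edges, such as `ℓ₀`, separates the regions of a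
diagram in the sphere into two classes (`exists_jump_eq`, that is, `H¹(S²; ℤ/2) = 0`, which follows
from Euler's formula by counting dimensions). For an edge `p` let `L p` be the class of the region
on its left. At a self-crossing of `ℓ₀` the signs `(-1)^L` of the four edges are such that the sum of
the increments of `(-1)^L f` at the two passages is, up to sign, the Fox relation; and the sum of
all increments along a closed component is zero. Similarly, with `s` the exponents of the signs of
the rotations, the increments of `(-1)^(L + s)` along the components other than `ℓ₀` are, up to
sign, the inhomogeneous terms of the system, so these add up to zero, too.
-/

/-! ### Regions of a planar diagram and cohomology of the sphere -/

namespace GaussDiagram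

open Module

variable (D : GaussDiagram)

/-- The mod 2 incidence matrix between crossings and edges; a loop has incidence `0`. -/
noncomputable def incidence [DecidableEq D.Crossing] :
    Matrix D.Crossing (D.Crossing × Bool) (ZMod 2) :=
  Matrix.of fun c p => (if c = p.1 then 1 else 0) + (if c = (D.next p).1 then 1 else 0)

theorem incidence_mulVec [DecidableEq D.Crossing] [Fintype D.Crossing]
    (g : D.Crossing × Bool → ZMod 2) (c : D.Crossing) :
    D.incidence.mulVec g c = (g (c, true) + g (c, false)) +
      (g (D.next.symm (c, true)) + g (D.next.symm (c, false))) := by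
  have h (k : D.Crossing × Bool → ZMod 2) :
      ∑ p : D.Crossing × Bool, (if c = p.1 then 1 else 0) * k p = k (c, true) + k (c, false) := by
    simp [Fintype.sum_prod_type, Finset.sum_add_distrib]
  simp only [Matrix.mulVec, dotProduct, incidence, Matrix.of_apply, add_mul,
    Finset.sum_add_distrib]
  rw [h g, ← h (fun p => g (D.next.symm p)),
    ← Equiv.sum_comp D.next (fun p => _ * g (D.next.symm p))]
  simp

theorem incidence_transpose_mulVec [DecidableEq D.Crossing] [Fintype D.Crossing]
    (φ : D.Crossing → ZMod 2) (p : D.Crossing × Bool) :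
    D.incidence.transpose.mulVec φ p = φ p.1 + φ (D.next p).1 := by
  simp [Matrix.mulVec, dotProduct, incidence, add_mul, Finset.sum_add_distrib]

/-- The mod 2 coboundary of a function `R` on the regions: the sum of its values on the two sides of
each edge. -/
def jump : (D.Face → ZMod 2) →ₗ[ZMod 2] (D.Crossing × Bool → ZMod 2) where
  toFun R p := R (Quotient.mk _ (p, true)) + R (Quotient.mk _ (D.next p, false))
  map_add' R R' := by ext p; simp only [Pi.add_apply]; ring
  map_smul' a R := by ext p; simp only [Pi.smul_apply, smul_eq_mul, RingHom.id_apply]; ring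

variable {D}

theorem face_mk_face (x : D.Dart) :
    (Quotient.mk _ (D.face x) : D.Face) = Quotient.mk _ x :=
  Quotient.sound (Equiv.Perm.sameCycle_apply_left.mpr (Equiv.Perm.SameCycle.refl D.face x))

/-- The dart reached by a left turn from an edge `e` has the same region on its left as `e`. The
other side of `e` belongs to the dart that sets out from `p` to travel back along `e`. -/
theorem apply_turnLeft (R : D.Face → ZMod 2) (p : D.Crossing × Bool) (b : Bool) :
    R (Quotient.mk _ (D.turnLeft (p, b))) = R (Quotient.mk _ (p, !b)) +
      D.jump R (if b = true then D.next.symm p else p) := by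
  have h : D.turnLeft (p, b) = D.face (D.travel.symm (p, b)) := by simp [face]
  rw [h, face_mk_face]
  cases b
  · simp only [jump, travel, LinearMap.coe_mk, AddHom.coe_mk, Equiv.coe_fn_symm_mk, Bool.not_false,
      Bool.false_eq_true, if_false]
    rw [← add_assoc, CharTwo.add_self_eq_zero, zero_add]
  · simp only [jump, travel, LinearMap.coe_mk, AddHom.coe_mk, Equiv.coe_fn_symm_mk, Bool.not_true,
      if_true, Equiv.apply_symm_apply]
    rw [add_left_comm, CharTwo.add_self_eq_zero, add_zero]

theorem turnLeft_over (c : D.Crossing) (b : Bool) :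
    D.turnLeft ((c, true), b) = ((c, false), if D.sign c = 1 then b else !b) := by
  simp [turnLeft]

theorem turnLeft_under (c : D.Crossing) (b : Bool) :
    D.turnLeft ((c, false), b) = ((c, true), if D.sign c = 1 then !b else b) := by
  by_cases h : D.sign c = 1 <;> simp [turnLeft, h]

/-- Around a crossing each of the four corners is counted twice. -/
theorem incidence_mulVec_jump [DecidableEq D.Crossing] [Fintype D.Crossing]
    (R : D.Face → ZMod 2) : D.incidence.mulVec (D.jump R) = 0 := by
  ext c
  rw [incidence_mulVec]
  have h1 := apply_turnLeft R (c, true) true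
  have h2 := apply_turnLeft R (c, true) false
  have h3 := apply_turnLeft R (c, false) true
  have h4 := apply_turnLeft R (c, false) false
  simp only [if_true, Bool.false_eq_true, if_false, turnLeft_over, turnLeft_under, Bool.not_true,
    Bool.not_false] at h1 h2 h3 h4
  by_cases h : D.sign c = 1 <;> simp only [h, if_true, if_false] at h1 h2 h3 h4 <;>
    simp only [Pi.zero_apply] <;>
    linear_combination -(h1 + h2 + h3 + h4)

/-- A function on the regions that agrees across every edge has one value around each crossing, and
this value is the same at the two ends of an edge. -/
theorem eq_of_jump_eq_zero {R : D.Face → ZMod 2} (hR : D.jump R = 0) (p : D.Crossing × Bool)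
    (b : Bool) : R (Quotient.mk _ (p, b)) = R (Quotient.mk _ ((p.1, true), true)) ∧
      R (Quotient.mk _ ((p.1, true), true)) =
        R (Quotient.mk _ (((D.next p).1, true), true)) := by
  have key (q : D.Crossing × Bool) (b : Bool) :
      R (Quotient.mk _ (q, b)) = R (Quotient.mk _ ((q.1, true), true)) := by
    obtain ⟨c, o⟩ := q
    have h1 := apply_turnLeft R (c, true) true
    have h2 := apply_turnLeft R (c, true) false
    have h3 := apply_turnLeft R (c, false) true
    have h4 := apply_turnLeft R (c, false) false
    simp only [if_true, Bool.false_eq_true, if_false, turnLeft_over, turnLeft_under,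
      Bool.not_true, Bool.not_false, hR, Pi.zero_apply, add_zero] at h1 h2 h3 h4
    by_cases h : D.sign c = 1 <;> simp only [h, if_true, if_false] at h1 h2 h3 h4 <;> cases o <;> cases b <;> simp_all
  refine ⟨key p b, ?_⟩
  rw [← key p true, ← key (D.next p) false]
  have := congrFun hR p
  exact CharTwo.add_eq_zero.mp this

/-- The first cohomology of the sphere with coefficients in `ℤ/2` vanishes: a mod 2 chain of edges
without boundary separates the regions into two classes. -/
theorem exists_jump_eq [DecidableEq D.Crossing] [Fintype D.Crossing] (hD : D.Planar)
    (g : D.Crossing × Bool → ZMod 2) (hg : D.incidence.mulVec g = 0) : ∃ R, D.jump R = g := by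
  classical
  have : Finite D.Face := Quotient.finite _
  have := Fintype.ofFinite D.Face
  have : Finite D.Piece := Quot.finite _
  have := Fintype.ofFinite D.Piece
  have hle : LinearMap.range D.jump ≤ LinearMap.ker D.incidence.mulVecLin := by
    rintro _ ⟨R, rfl⟩
    simpa using incidence_mulVec_jump R
  have hk0 : finrank (ZMod 2) (LinearMap.ker D.jump) ≤ Fintype.card D.Piece := by
    let T : (D.Face → ZMod 2) →ₗ[ZMod 2] (D.Piece → ZMod 2) :=
      LinearMap.funLeft (ZMod 2) (ZMod 2) fun π => Quotient.mk _ ((π.out, true), true)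
    rw [← Module.finrank_fintype_fun_eq_card (ZMod 2) (η := D.Piece)]
    apply LinearMap.finrank_le_finrank_of_injective (f := T ∘ₗ (LinearMap.ker D.jump).subtype)
    rw [injective_iff_map_eq_zero]
    rintro ⟨R, hR⟩ h
    have hR' : D.jump R = 0 := hR
    ext φ
    induction φ using Quotient.inductionOn with | _ x
    let ψ : D.Piece → ZMod 2 := Quot.lift (fun c => R (Quotient.mk _ ((c, true), true))) (by
      rintro c c' ⟨o, rfl⟩
      exact (eq_of_jump_eq_zero hR' (c, o) true).2)
    have h1 : R (Quotient.mk _ x) = ψ (Quot.mk _ x.1.1) := (eq_of_jump_eq_zero hR' x.1 x.2).1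
    have h2 := congrFun h (Quot.mk _ x.1.1)
    have h3 : ψ (Quot.mk _ (Quot.out (Quot.mk _ x.1.1 : D.Piece))) = 0 := h2
    rw [Quot.out_eq] at h3
    exact h1.trans h3
  have hk1 : finrank (ZMod 2) (LinearMap.ker D.incidence.transpose.mulVecLin) ≤
      Fintype.card D.Piece := by
    let T : (D.Piece → ZMod 2) →ₗ[ZMod 2] (D.Crossing → ZMod 2) :=
      LinearMap.funLeft (ZMod 2) (ZMod 2) (Quot.mk _)
    have h : LinearMap.ker D.incidence.transpose.mulVecLin ≤ LinearMap.range T := by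
      intro φ hφ
      have hφ' : D.incidence.transpose.mulVec φ = 0 := hφ
      refine ⟨Quot.lift φ ?_, rfl⟩
      rintro c c' ⟨o, rfl⟩
      have := congrFun hφ' (c, o)
      rw [incidence_transpose_mulVec] at this
      exact CharTwo.add_eq_zero.mp this
    refine (Submodule.finrank_mono h).trans ((LinearMap.finrank_range_le T).trans ?_)
    rw [Module.finrank_fintype_fun_eq_card]
  have e1 := D.jump.finrank_range_add_finrank_ker
  have e2 := D.incidence.mulVecLin.finrank_range_add_finrank_ker
  have e3 := D.incidence.transpose.mulVecLin.finrank_range_add_finrank_ker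
  have e4 : finrank (ZMod 2) (LinearMap.range D.incidence.transpose.mulVecLin) =
      finrank (ZMod 2) (LinearMap.range D.incidence.mulVecLin) := D.incidence.rank_transpose
  have e5 := hD
  simp only [Planar, Nat.card_eq_fintype_card] at e5
  simp only [Module.finrank_fintype_fun_eq_card, Fintype.card_prod, Fintype.card_bool] at e1 e2 e3
  have := Submodule.eq_of_le_of_finrank_le hle (by omega)
  have hg' : g ∈ LinearMap.ker D.incidence.mulVecLin := hg
  rwa [← this] at hg'

/-- Checkerboard colouring relative to a union of components with indicator `l`: `L p` is the
class of the region on the left of the edge that leaves `p`. -/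
theorem exists_checkerboard (hD : D.Planar) (l : D.Crossing × Bool → ZMod 2)
    (hl : ∀ p, l (D.next.symm p) = l p) :
    ∃ L : D.Crossing × Bool → ZMod 2, ∀ c,
      (∀ o, L (c, o) = L (D.next.symm (c, o)) + l (c, !o)) ∧
      (D.sign c = 1 → L (c, false) = L (c, true) + l (c, false)) ∧
      (D.sign c = -1 → L (c, true) = L (c, false) + l (c, true)) := by
  classical
  have := Fintype.ofFinite D.Crossing
  obtain ⟨R, hR⟩ := exists_jump_eq hD l (by
    ext c
    rw [incidence_mulVec, hl, hl, CharTwo.add_self_eq_zero, Pi.zero_apply])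
  refine ⟨fun p => R (Quotient.mk _ (p, true)), fun c => ?_⟩
  have j1 := congrFun hR (D.next.symm (c, true))
  have j2 := congrFun hR (D.next.symm (c, false))
  have h1 := apply_turnLeft R (c, true) true
  have h2 := apply_turnLeft R (c, true) false
  have h3 := apply_turnLeft R (c, false) true
  have h4 := apply_turnLeft R (c, false) false
  simp only [jump, LinearMap.coe_mk, AddHom.coe_mk, Equiv.apply_symm_apply, hl] at j1 j2
  simp only [if_true, Bool.false_eq_true, if_false, turnLeft_over, turnLeft_under, Bool.not_true,
    Bool.not_false, hR, hl] at h1 h2 h3 h4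
  have hne : (-1 : ℤˣ) ≠ 1 := by decide
  have hs : D.sign c = 1 ∨ D.sign c = -1 := Int.units_eq_one_or _
  rcases hs with h | h <;>
    simp only [h, hne, hne.symm, if_true, if_false, Bool.not_true, Bool.not_false,
      Bool.forall_bool, true_implies, false_implies, and_true, true_and] at h1 h2 h3 h4 ⊢
  · refine ⟨⟨?_, ?_⟩, ?_⟩
    · linear_combination (norm := (ring_nf; reduce_mod_char)) h1 + h3 + j2
    · linear_combination (norm := (ring_nf; reduce_mod_char)) h1 + h4 + j1
    · linear_combination (norm := (ring_nf; reduce_mod_char)) h4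
  · refine ⟨⟨?_, ?_⟩, ?_⟩
    · linear_combination (norm := (ring_nf; reduce_mod_char)) h2 + h3 + j2
    · linear_combination (norm := (ring_nf; reduce_mod_char)) h1 + h3 + j1
    · linear_combination (norm := (ring_nf; reduce_mod_char)) h2

end GaussDiagram

/-! ### Fox colourings -/

namespace GaussDiagram

/-- The Fox relations at the crossing `c` for a colouring `f` of the edges: the over strand keeps
its colour, and the colours of the two under edges add up to twice that of the over strand. -/
def IsFoxAt {C R : Type*} [CommRing R] (σ : Equiv.Perm (C × Bool)) (f : C × Bool → R) (c : C) :
    Prop :=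
  f (c, true) = f (σ.symm (c, true)) ∧ f (c, false) + f (σ.symm (c, false)) = 2 * f (c, true)

/-- Both strands keep their colours at the crossing `c`, as if it were not there. -/
def PassesAt {C R : Type*} (σ : Equiv.Perm (C × Bool)) (f : C × Bool → R) (c : C) : Prop :=
  ∀ o, f (c, o) = f (σ.symm (c, o))

/-- All Fox colourings of `D` with values in `R`, the crossings in `T` being ignored, are
constant. The edges are coloured by `f` and the circles without crossings by `g`. -/
def FoxRigidOff (D : GaussDiagram) (R : Type*) [CommRing R] (T : Set D.Crossing) : Prop :=
  ∀ (f : D.Crossing × Bool → R) (g : D.Circle → R), (∀ c ∉ T, IsFoxAt D.next f c) →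
    (∀ c ∈ T, PassesAt D.next f c) → ∃ u, (∀ p, f p = u) ∧ ∀ t, g t = u

/-- All Fox colourings of `D` with values in `R` are constant. -/
def FoxRigid (D : GaussDiagram) (R : Type*) [CommRing R] : Prop :=
  ∀ (f : D.Crossing × Bool → R) (g : D.Circle → R), (∀ c, IsFoxAt D.next f c) →
    ∃ u, (∀ p, f p = u) ∧ ∀ t, g t = u

/-- The passages `p` and `q` are the ends of an edge. -/
def Adjacent {E : Type*} (σ : Equiv.Perm E) (p q : E) : Prop := σ p = q ∨ σ q = p

variable {D : GaussDiagram} {R : Type*} [CommRing R]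

theorem Adjacent.symm {E : Type*} {σ : Equiv.Perm E} {p q : E} (h : Adjacent σ p q) :
    Adjacent σ q p := Or.symm h

/-! ### Colourings of sublinks -/

theorem componentOf_next (p : D.Crossing × Bool) :
    D.componentOf (D.next p) = D.componentOf p :=
  congrArg Sum.inl (Quotient.sound
    (Equiv.Perm.sameCycle_apply_left.mpr (Equiv.Perm.SameCycle.refl D.next p)))

theorem componentOf_next_symm (p : D.Crossing × Bool) :
    D.componentOf (D.next.symm p) = D.componentOf p := by
  rw [← componentOf_next, Equiv.apply_symm_apply]

theorem componentOf_eq_iff {p q : D.Crossing × Bool} :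
    D.componentOf p = D.componentOf q ↔ D.next.SameCycle p q := by
  rw [componentOf, componentOf, Sum.inl.injEq]
  exact Quotient.eq

/-- The passage of `D` that corresponds to a passage of a restriction of `D`. -/
def ofRestrict {K : Set D.Component} {S : Set D.Crossing}
    (q : (D.restrict K S).Crossing × Bool) : D.Crossing × Bool := (q.1.1, q.2)

theorem ofRestrict_next {K : Set D.Component} {S : Set D.Crossing}
    (q : (D.restrict K S).Crossing × Bool) :
    ∃ k, ofRestrict ((D.restrict K S).next q) = (D.next ^ (k + 1)) (ofRestrict q) ∧
      ∀ j < k, ((D.next ^ (j + 1)) (ofRestrict q)).1 ∉ S := by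
  refine ⟨D.next.returnTime {p | p.1 ∈ S} ⟨ofRestrict q, q.1.2⟩, rfl, fun j hj h => ?_⟩
  have := D.next.returnTime_min {p | p.1 ∈ S} ⟨ofRestrict q, q.1.2⟩ (k := j) h
  omega

theorem componentOf_next_pow (p : D.Crossing × Bool) (k : ℕ) :
    D.componentOf ((D.next ^ k) p) = D.componentOf p :=
  componentOf_eq_iff.mpr ((Equiv.Perm.sameCycle_pow_left (n := k)).mpr
    (Equiv.Perm.SameCycle.refl D.next p))

/-- A colouring of `D` that does not change at the forgotten crossings has the same colours on
both sides of a remaining passage as the colouring it induces on the restriction. -/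
theorem apply_next_symm_ofRestrict {α : Type*} {K : Set D.Component} {S : Set D.Crossing}
    (hS : ∀ c ∈ S, ∀ o, D.componentOf (c, o) ∈ K) {f : D.Crossing × Bool → α}
    (hf : ∀ p, p.1 ∉ S → D.componentOf p ∈ K → f p = f (D.next.symm p))
    (q : (D.restrict K S).Crossing × Bool) :
    f (D.next.symm (ofRestrict q)) = f (ofRestrict ((D.restrict K S).next.symm q)) := by
  obtain ⟨q, rfl⟩ := (D.restrict K S).next.surjective q
  obtain ⟨k, hk, hlt⟩ := ofRestrict_next q
  rw [Equiv.symm_apply_apply, hk, pow_succ', Equiv.Perm.mul_apply, Equiv.symm_apply_apply]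
  have h : ∀ j ≤ k, f ((D.next ^ j) (ofRestrict q)) = f (ofRestrict q) := by
    intro j
    induction j with
    | zero => intro _; rfl
    | succ j ih =>
      intro hj
      rw [hf _ (hlt j (by omega)) (by rw [componentOf_next_pow]; exact hS _ q.1.2 _), pow_succ',
        Equiv.Perm.mul_apply, Equiv.symm_apply_apply]
      exact ih (by omega)
  exact h k le_rfl

theorem exists_symm_pow_eq {p q : D.Crossing × Bool} (h : D.componentOf p = D.componentOf q) :
    ∃ j : ℕ, (D.next.symm ^ j) p = q := by
  have h' : (D.next⁻¹).SameCycle p q := (componentOf_eq_iff.mp h).inv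
  obtain ⟨j, -, hj⟩ := h'.exists_pow_eq'
  exact ⟨j, hj⟩

/-- Walking `j` steps backwards along a component, the colour stays the same until a passage through
a crossing in `S` is met. -/
theorem exists_mem_apply_eq {α : Type*} {S : Set D.Crossing} {f : D.Crossing × Bool → α}
    (j : ℕ) {p : D.Crossing × Bool}
    (hf : ∀ q, q.1 ∉ S → D.componentOf q = D.componentOf p → f q = f (D.next.symm q)) :
    f p = f ((D.next.symm ^ j) p) ∨ ∃ q : D.Crossing × Bool, q.1 ∈ S ∧ f p = f q := by
  induction j generalizing p with
  | zero => exact Or.inl rfl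
  | succ j ih =>
    by_cases hp : p.1 ∈ S
    · exact Or.inr ⟨p, hp, rfl⟩
    · have := ih (p := D.next.symm p) (by simpa only [componentOf_next_symm] using hf)
      rwa [← hf p hp rfl, ← Equiv.Perm.mul_apply, ← pow_succ] at this

/-- If the Fox colourings of a sublink are constant, then so are the colourings of its edges in
the whole diagram that satisfy the Fox relations at its own crossings and do not change at the
other ones. -/
theorem FoxRigid.of_restrict {K : Set D.Component} {S : Set D.Crossing}
    (hS : ∀ c ∈ S, ∀ o, D.componentOf (c, o) ∈ K) (h : FoxRigid (D.restrict K S) R)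
    (f : D.Crossing × Bool → R) (g : D.Circle → R) (hfox : ∀ c ∈ S, IsFoxAt D.next f c)
    (hpass : ∀ p, p.1 ∉ S → D.componentOf p ∈ K → f p = f (D.next.symm p)) :
    ∃ u, (∀ p, D.componentOf p ∈ K → f p = u) ∧ ∀ t, Sum.inr t ∈ K → g t = u := by
  obtain ⟨u, hu, hu'⟩ := h (fun q => f (ofRestrict q))
    (fun j => Sum.elim (fun a => f a.out) g j.1) (by
      intro c
      have := hfox c.1 c.2
      have h1 := apply_next_symm_ofRestrict hS hpass (c, true)
      have h2 := apply_next_symm_ofRestrict hS hpass (c, false)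
      unfold IsFoxAt
      beta_reduce
      rw [← h1, ← h2]
      exact this)
  refine ⟨u, fun p hp => ?_, fun t ht => ?_⟩
  · have hq : ∀ q : D.Crossing × Bool, q.1 ∈ S → f q = u := fun q hq => hu (⟨q.1, hq⟩, q.2)
    have hf (q) (hq : q.1 ∉ S) (hqp : D.componentOf q = D.componentOf p) :=
      hpass q hq (hqp ▸ hp)
    by_cases hex : ∃ q : D.Crossing × Bool, q.1 ∈ S ∧ D.componentOf q = D.componentOf p
    · obtain ⟨q, hqS, hqp⟩ := hex
      obtain ⟨j, hj⟩ := exists_symm_pow_eq hqp.symm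
      rcases exists_mem_apply_eq j hf with h1 | ⟨q', hq', h1⟩
      · rw [h1, hj, hq q hqS]
      · rw [h1, hq q' hq']
    · push Not at hex
      have hout : D.componentOf (Quotient.out (Quotient.mk
          (Equiv.Perm.SameCycle.setoid D.next) p)) = D.componentOf p :=
        congrArg Sum.inl (Quotient.out_eq _)
      obtain ⟨j, hj⟩ := exists_symm_pow_eq hout.symm
      have h2 : f (Quotient.out (Quotient.mk (Equiv.Perm.SameCycle.setoid D.next) p)) = u :=
        hu' ⟨D.componentOf p, hp, hex⟩
      rcases exists_mem_apply_eq j hf with h1 | ⟨q', hq', h1⟩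
      · rw [h1, hj, h2]
      · rw [h1, hq q' hq']
  · exact hu' ⟨Sum.inr t, ht, fun p _ => by simp [componentOf]⟩

open Classical in
/-- A colouring of the diagram without the crossings in `T` extends to a colouring of `D` that
does not change at these crossings. -/
theorem exists_extension {α : Type*} {K : Set D.Component} {S : Set D.Crossing} (hK : ∀ j, j ∈ K)
    (f : (D.restrict K S).Crossing × Bool → α) (g : (D.restrict K S).Circle → α) :
    ∃ F : D.Crossing × Bool → α, (∀ q, F (ofRestrict q) = f q) ∧
      (∀ p, p.1 ∉ S → F p = F (D.next.symm p)) ∧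
      ∀ p h, F p = g ⟨D.componentOf p, h⟩ := by
  let P (p : D.Crossing × Bool) (j : ℕ) : Prop := ((D.next.symm ^ j) p).1 ∈ S
  have hcirc (p) (h : ¬ ∃ j, P p j) : D.componentOf p ∈ K ∧
      ∀ q : D.Crossing × Bool, q.1 ∈ S → D.componentOf q ≠ D.componentOf p := by
    refine ⟨hK _, fun q hq hqp => h ?_⟩
    obtain ⟨j, hj⟩ := exists_symm_pow_eq hqp.symm
    exact ⟨j, by simpa only [P, hj] using hq⟩
  let F (p : D.Crossing × Bool) : α := if h : ∃ j, P p j then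
    f (⟨((D.next.symm ^ Nat.find h) p).1, Nat.find_spec h⟩, ((D.next.symm ^ Nat.find h) p).2)
    else g ⟨D.componentOf p, hcirc p h⟩
  refine ⟨F, fun q => ?_, fun p hp => ?_, fun p h => ?_⟩
  · have h : ∃ j, P (ofRestrict q) j := ⟨0, q.1.2⟩
    have h0 : Nat.find h = 0 := (Nat.find_eq_zero h).mpr q.1.2
    simp only [F, dif_pos h, h0, pow_zero, Equiv.Perm.one_apply]
    rfl
  · have hsucc (j : ℕ) : P p (j + 1) ↔ P (D.next.symm p) j := by
      simp only [P, pow_succ, Equiv.Perm.mul_apply]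
    by_cases h : ∃ j, P (D.next.symm p) j
    · have h2 : ∃ j, P p (j + 1) := by simpa only [hsucc] using h
      have h1 : ∃ j, P p j := h2.imp' (· + 1) fun _ => id
      have hfind : Nat.find h1 = Nat.find h + 1 := by
        rw [Nat.find_comp_succ h1 h2 hp]
        congr 1
      simp only [F, dif_pos h, dif_pos h1, hfind, pow_succ, Equiv.Perm.mul_apply]
    · have h1 : ¬ ∃ j, P p j := by
        rintro ⟨_ | j, hj⟩
        · exact hp hj
        · exact h ⟨j, (hsucc j).mp hj⟩
      simp only [F, dif_neg h, dif_neg h1, componentOf_next_symm]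
  · have h1 : ¬ ∃ j, P p j := by
      rintro ⟨j, hj⟩
      refine h.2 _ hj ?_
      rw [componentOf_eq_iff]
      exact (Equiv.Perm.sameCycle_inv.mp ((Equiv.Perm.sameCycle_pow_left (n := j)).mpr
        (Equiv.Perm.SameCycle.refl D.next⁻¹ p)))
    simp only [F, dif_neg h1]

theorem foxRigid_eraseCrossings (T : Set D.Crossing) :
    FoxRigid (D.eraseCrossings T) R ↔ FoxRigidOff D R T := by
  change FoxRigid (D.restrict Set.univ Tᶜ) R ↔ _
  constructor
  · intro h f g hfox hpass
    obtain ⟨u, hu, hu'⟩ := h.of_restrict (fun _ _ _ => Set.mem_univ _) f g hfox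
      (fun p hp _ => hpass p.1 (not_not.mp hp) p.2)
    exact ⟨u, fun p => hu p (Set.mem_univ _), fun t => hu' t (Set.mem_univ _)⟩
  · intro h f g hfox
    obtain ⟨F, hF, hpass, hcirc⟩ := exists_extension (fun _ => Set.mem_univ _) f g
    obtain ⟨u, hu, hu'⟩ := h F
      (fun t => g ⟨Sum.inr t, Set.mem_univ _, fun p _ => by simp [componentOf]⟩) (by
        intro c hc
        let c' : (D.restrict Set.univ Tᶜ).Crossing := ⟨c, hc⟩
        have h (o) := apply_next_symm_ofRestrict (K := Set.univ) (S := Tᶜ)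
          (fun _ _ _ => Set.mem_univ _) (fun p hp _ => hpass p hp) (c', o)
        have := hfox c'
        unfold IsFoxAt at this
        rw [← hF, ← hF, ← hF, ← hF, ← h, ← h] at this
        exact this)
      (fun c hc o => hpass (c, o) (not_not.mpr hc))
    refine ⟨u, fun q => by rw [← hF, hu], ?_⟩
    rintro ⟨j | t, hj⟩
    · induction j using Quotient.inductionOn with | _ p
      exact (hcirc p hj).symm.trans (hu p)
    · exact hu' t

/-! ### Invariance under the Reidemeister moves -/

theorem adjacent_target (x : D.Dart) : Adjacent D.next x.1 (D.target x) := by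
  obtain ⟨p, _ | _⟩ := x
  · exact Or.inr (by simp [target, travel])
  · exact Or.inl (by simp [target, travel])

theorem target_of_face_eq {x y : D.Dart} (h : D.face x = y) : D.target x = (y.1.1, !y.1.2) := by
  subst h
  simp [face, turnLeft, target]

theorem isFoxAt_iff_passesAt_of_adjacent {C : Type*} {σ : Equiv.Perm (C × Bool)} {c : C}
    (h : Adjacent σ (c, true) (c, false)) (f : C × Bool → R) :
    IsFoxAt σ f c ↔ PassesAt σ f c := by
  simp only [IsFoxAt, PassesAt, Bool.forall_bool]
  rcases h with h | h
  · rw [← h, Equiv.symm_apply_apply, h]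
    constructor
    · rintro ⟨h1, h2⟩
      exact ⟨by linear_combination h2, h1⟩
    · rintro ⟨h1, h2⟩
      exact ⟨h2, by linear_combination h1⟩
  · rw [← h, Equiv.symm_apply_apply, h]
    constructor
    · rintro ⟨h1, h2⟩
      exact ⟨by linear_combination -h2 - 2 * h1, h1⟩
    · rintro ⟨h1, h2⟩
      exact ⟨h2, by linear_combination -h1 - 2 * h2⟩

/-- The first Reidemeister move. -/
theorem foxRigid_of_monogon {x : D.Dart} (h : D.face x = x) :
    FoxRigid D R ↔ FoxRigidOff D R {x.1.1} := by
  have hadj : Adjacent D.next (x.1.1, true) (x.1.1, false) := by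
    have h1 := adjacent_target x
    rw [target_of_face_eq h] at h1
    obtain ⟨⟨c, _ | _⟩, b⟩ := x
    · exact h1.symm
    · exact h1
  simp only [FoxRigid, FoxRigidOff]
  refine forall₂_congr fun f g => ⟨fun H h1 h2 => H fun c => ?_, fun H h1 => H (fun c _ => h1 c) ?_⟩
  · by_cases hc : c = x.1.1
    · subst hc
      exact (isFoxAt_iff_passesAt_of_adjacent hadj f).mpr (h2 _ rfl)
    · exact h1 c hc
  · rintro c rfl
    exact (isFoxAt_iff_passesAt_of_adjacent hadj f).mp (h1 _)

/-- The second Reidemeister move: only the colour of the edge between the two under-passages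
changes, from that of its neighbours to its reflection in the colour of the over strand. -/
theorem foxRigid_of_bigon {c d : D.Crossing} (hne : c ≠ d)
    (hunder : D.next (c, false) = (d, false)) (hover : Adjacent D.next (c, true) (d, true)) :
    FoxRigid D R ↔ FoxRigidOff D R {c, d} := by
  classical
  have hin : D.next.symm (d, false) = (c, false) := by rw [← hunder, Equiv.symm_apply_apply]
  have hout : (d, false) ≠ (c, false) := by simp [hne.symm]
  have hin' : D.next.symm (c, false) ≠ (c, false) := by
    intro h
    rw [Equiv.symm_apply_eq, hunder] at h
    exact hout h.symm
  have hsymm {p : D.Crossing × Bool} (hp : p ≠ (d, false)) : D.next.symm p ≠ (c, false) := by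
    intro h
    rw [Equiv.symm_apply_eq, hunder] at h
    exact hp h
  have hX {f : D.Crossing × Bool → R} (h1 : f (c, true) = f (D.next.symm (c, true)))
      (h2 : f (d, true) = f (D.next.symm (d, true))) : f (c, true) = f (d, true) := by
    rcases hover with h | h
    · rw [h2, ← h, Equiv.symm_apply_apply]
    · rw [h1, ← h, Equiv.symm_apply_apply]
  -- Recolouring the edge that leaves `(c, false)` affects no other crossing.
  have hfox {f : D.Crossing × Bool → R} {v : R} {e : D.Crossing} (hc : e ≠ c) (hd : e ≠ d) :
      IsFoxAt D.next (Function.update f (c, false) v) e ↔ IsFoxAt D.next f e := by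
    simp [IsFoxAt, hsymm, hc, hd]
  constructor
  · intro H f g h1 h2
    have hc := h2 c (by simp)
    have hd := h2 d (by simp)
    obtain ⟨u, hu, hu'⟩ := H
      (Function.update f (c, false) (2 * f (c, true) - f (D.next.symm (c, false)))) g (by
        intro e
        by_cases hec : e = c
        · subst hec
          simpa [IsFoxAt, Function.update_apply, hsymm, hin'] using hc true
        by_cases hed : e = d
        · subst hed
          have e1 := hd false
          have e2 := hc false
          have e3 := hX (hc true) (hd true)
          rw [hin] at e1
          simp only [IsFoxAt, Function.update_apply, hsymm, hin, hout, Prod.mk.injEq,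
            if_true, if_false, Bool.true_eq_false, and_false, ne_eq, not_false_eq_true]
          exact ⟨hd true, by linear_combination e1 + e2 + 2 * e3⟩
        · exact (hfox hec hed).mpr (h1 e (by simp [hec, hed])))
    refine ⟨u, fun p => ?_, hu'⟩
    by_cases hp : p = (c, false)
    · have e1 := hd false
      have e2 := hu (d, false)
      rw [Function.update_of_ne hout] at e2
      rw [hp, ← e2, e1, hin]
    · rw [← hu p, Function.update_of_ne hp]
  · intro H f g h1
    have hc := h1 c
    have hd := h1 d
    obtain ⟨u, hu, hu'⟩ := H
      (Function.update f (c, false) (f (D.next.symm (c, false)))) g (by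
        intro e he
        simp only [Set.mem_insert_iff, Set.mem_singleton_iff, not_or] at he
        exact (hfox he.1 he.2).mpr (h1 e)) (by
        have e1 := hc.2
        have e2 := hd.2
        have e3 := hX hc.1 hd.1
        rw [hin] at e2
        rintro e (rfl | rfl) (_ | _)
        · simp [hin']
        · simpa [Function.update_apply, hsymm] using hc.1
        · simp only [Function.update_apply, hin, hout, if_true, if_false]
          linear_combination e2 - e1 - 2 * e3
        · simpa [Function.update_apply, hsymm] using hd.1)
    refine ⟨u, fun p => ?_, hu'⟩
    by_cases hp : p = (c, false)
    · have e1 := hc.2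
      have e2 := hu (D.next.symm (c, false))
      have e3 := hu (c, true)
      rw [Function.update_of_ne hin'] at e2
      rw [Function.update_of_ne (by simp)] at e3
      rw [hp]
      linear_combination e1 - e2 + 2 * e3
    · rw [← hu p, Function.update_of_ne hp]

end GaussDiagram

namespace GaussDiagram

/-- The permutation `τ` exchanges `a` with `b`, `c` with `d` and `e` with `f`, and nothing else. -/
structure IsTripleSwap {E : Type*} (τ : Equiv.Perm E) (a b c d e f : E) : Prop where
  swap₁ : τ a = b
  swap₂ : τ c = d
  swap₃ : τ e = f
  apply_apply : ∀ p, τ (τ p) = p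
  apply_of_ne : ∀ p, p ≠ a → p ≠ b → p ≠ c → p ≠ d → p ≠ e → p ≠ f → τ p = p

theorem IsTripleSwap.inv_eq {E : Type*} {τ : Equiv.Perm E} {a b c d e f : E}
    (h : IsTripleSwap τ a b c d e f) : τ⁻¹ = τ :=
  Equiv.ext fun p => by rw [Equiv.Perm.inv_eq_iff_eq, h.apply_apply]

theorem isTripleSwap_swap {E : Type*} [DecidableEq E] {a b c d e f : E}
    (h : [a, b, c, d, e, f].Nodup) :
    IsTripleSwap (Equiv.swap a b * Equiv.swap c d * Equiv.swap e f) a b c d e f := by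
  simp only [List.nodup_cons, List.mem_cons, List.not_mem_nil, or_false, not_or, not_false_eq_true,
    List.nodup_nil, and_true] at h
  obtain ⟨⟨-, ac, ad, ae, af⟩, ⟨bc, bd, be, bf⟩, ⟨-, ce, cf⟩, ⟨de, df⟩, -⟩ := h
  have ha : Equiv.swap a b * Equiv.swap c d = Equiv.swap c d * Equiv.swap a b :=
    (Equiv.Perm.disjoint_iff_eq_or_eq.mpr fun p => by
      simp only [Equiv.swap_apply_def]; grind).commute
  have hb : Equiv.swap a b * Equiv.swap e f = Equiv.swap e f * Equiv.swap a b :=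
    (Equiv.Perm.disjoint_iff_eq_or_eq.mpr fun p => by
      simp only [Equiv.swap_apply_def]; grind).commute
  have hc : Equiv.swap c d * Equiv.swap e f = Equiv.swap e f * Equiv.swap c d :=
    (Equiv.Perm.disjoint_iff_eq_or_eq.mpr fun p => by
      simp only [Equiv.swap_apply_def]; grind).commute
  have hsq : (Equiv.swap a b * Equiv.swap c d * Equiv.swap e f) *
      (Equiv.swap a b * Equiv.swap c d * Equiv.swap e f) = 1 := by
    have : Commute (Equiv.swap a b * Equiv.swap c d) (Equiv.swap e f) :=
      Commute.mul_left hb hc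
    rw [this.symm.mul_mul_mul_comm, (show Commute _ _ from ha).symm.mul_mul_mul_comm]
    simp
  refine ⟨?_, ?_, ?_, fun p => by rw [← Equiv.Perm.mul_apply, hsq]; rfl, ?_⟩
  · simp only [Equiv.Perm.mul_apply, Equiv.swap_apply_of_ne_of_ne ae af,
      Equiv.swap_apply_of_ne_of_ne ac ad, Equiv.swap_apply_left]
  · simp only [Equiv.Perm.mul_apply, Equiv.swap_apply_of_ne_of_ne ce cf,
      Equiv.swap_apply_of_ne_of_ne (Ne.symm ad) (Ne.symm bd), Equiv.swap_apply_left]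
  · simp only [Equiv.Perm.mul_apply, Equiv.swap_apply_of_ne_of_ne (Ne.symm cf) (Ne.symm df),
      Equiv.swap_apply_of_ne_of_ne (Ne.symm af) (Ne.symm bf), Equiv.swap_apply_left]
  · intro p h1 h2 h3 h4 h5 h6
    simp only [Equiv.Perm.mul_apply, Equiv.swap_apply_of_ne_of_ne h5 h6,
      Equiv.swap_apply_of_ne_of_ne h3 h4, Equiv.swap_apply_of_ne_of_ne h1 h2]

/-- The colours next to the passages `p` and `q`, which are the ends of an edge, before (`f`, `σ`)
and after (`f'`, `σ'`) the exchange of `p` and `q`: the edge between them changes its colour from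
`w` to `v`, and the outer edges keep their colours. -/
def IsExchangedStrand {E α : Type*} (σ σ' : Equiv.Perm E) (f f' : E → α) (p q : E)
    (w v : α) : Prop :=
  (f p = w ∧ f (σ.symm q) = w ∧ f' q = v ∧ f' p = f q ∧ f' (σ'.symm q) = f (σ.symm p) ∧
      f' (σ'.symm p) = v) ∨
    (f q = w ∧ f (σ.symm p) = w ∧ f' p = v ∧ f' q = f p ∧ f' (σ'.symm p) = f (σ.symm q) ∧
      f' (σ'.symm q) = v)

namespace IsExchangedStrand

variable {E α : Type*} {σ σ' : Equiv.Perm E} {f f' : E → α} {p q : E} {w v : α}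

theorem symm (h : IsExchangedStrand σ σ' f f' p q w v) : IsExchangedStrand σ σ' f f' q p w v :=
  Or.symm h

theorem eq_of_eq (h : IsExchangedStrand σ σ' f f' p q w v) (hp : f p = f (σ.symm p)) :
    f p = w := by
  rcases h with h | h
  · exact h.1
  · rw [hp, h.2.1]

theorem add_eq [CommRing α] (h : IsExchangedStrand σ σ' f f' p q w v) :
    f' p + f' (σ'.symm p) = f q + f (σ.symm q) - w + v := by
  rcases h with ⟨-, h2, -, h4, -, h6⟩ | ⟨h1, -, h3, -, h5, -⟩
  · rw [h2, h4, h6]; ring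
  · rw [h1, h3, h5]; ring

theorem eq_and_eq [CommRing α] (h : IsExchangedStrand σ σ' f f' p q w v)
    (hq : f q + f (σ.symm q) = w + v) : f' p = v ∧ f' (σ'.symm p) = v := by
  rcases h with ⟨-, h2, -, h4, -, h6⟩ | ⟨h1, -, h3, -, h5, -⟩
  · exact ⟨by rw [h4]; linear_combination hq - h2, h6⟩
  · exact ⟨h3, by rw [h5]; linear_combination hq - h1⟩

theorem eq_of_forall_eq (h : IsExchangedStrand σ σ' f f' p q w v) {u : α} (hu : ∀ p, f' p = u) :
    v = u := by
  rcases h with h | h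
  · rw [← h.2.2.1, hu]
  · rw [← h.2.2.1, hu]

end IsExchangedStrand

/-- Exchanging the passages at the ends of three disjoint edges: a colouring `f` of the edges gives
a colouring `f'` after the exchange, in which the exchanged edges have arbitrary colours and all
others keep theirs. -/
theorem exists_exchanged_colouring {E α : Type*} {σ τ σ' : Equiv.Perm E}
    {p₁ q₁ p₂ q₂ p₃ q₃ : E} (hnodup : [p₁, q₁, p₂, q₂, p₃, q₃].Nodup)
    (hτ : IsTripleSwap τ p₁ q₁ p₂ q₂ p₃ q₃) (h₁ : Adjacent σ p₁ q₁) (h₂ : Adjacent σ p₂ q₂)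
    (h₃ : Adjacent σ p₃ q₃) (hσ' : σ' = τ * σ * τ⁻¹) (f : E → α) :
    ∃ w₁ w₂ w₃ : α, ∀ v₁ v₂ v₃, ∃ f' : E → α,
      IsExchangedStrand σ σ' f f' p₁ q₁ w₁ v₁ ∧ IsExchangedStrand σ σ' f f' p₂ q₂ w₂ v₂ ∧
      IsExchangedStrand σ σ' f f' p₃ q₃ w₃ v₃ ∧
      (∀ p ∉ [p₁, q₁, p₂, q₂, p₃, q₃], f' p = f p ∧ f' (σ'.symm p) = f (σ.symm p)) ∧
      ∀ u, (∀ p, f' p = u) → w₁ = u → w₂ = u → w₃ = u → ∀ p, f p = u := by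
  classical
  have key : ∀ {p q}, τ p = q → Adjacent σ p q → ∃ m, τ m = σ m ∧
      (m = p ∧ σ m = q ∨ m = q ∧ σ m = p) := by
    rintro p q hp (h | h)
    · exact ⟨p, hp.trans h.symm, Or.inl ⟨rfl, h⟩⟩
    · exact ⟨q, by rw [h, ← hp, hτ.apply_apply], Or.inr ⟨rfl, h⟩⟩
  obtain ⟨m₁, t1, k1⟩ := key hτ.swap₁ h₁
  obtain ⟨m₂, t2, k2⟩ := key hτ.swap₂ h₂
  obtain ⟨m₃, t3, k3⟩ := key hτ.swap₃ h₃
  have hm : [m₁, σ m₁, m₂, σ m₂, m₃, σ m₃].Nodup := by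
    simp only [List.nodup_cons, List.mem_cons, List.not_mem_nil, or_false, not_or,
      not_false_eq_true, List.nodup_nil, and_true] at hnodup ⊢
    clear key hτ
    rcases k1 with ⟨k, k'⟩ | ⟨k, k'⟩ <;> rcases k2 with ⟨l, l'⟩ | ⟨l, l'⟩ <;>
      rcases k3 with ⟨m, m'⟩ | ⟨m, m'⟩ <;> rw [k', l', m', k, l, m] <;> grind (splits := 20)
  have hmem (p) : p ∈ [p₁, q₁, p₂, q₂, p₃, q₃] ↔ p ∈ [m₁, σ m₁, m₂, σ m₂, m₃, σ m₃] := by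
    simp only [List.mem_cons, List.not_mem_nil, or_false]
    grind
  have hinv : τ⁻¹ = τ := hτ.inv_eq
  have t1' : τ (σ m₁) = m₁ := by rw [← t1, hτ.apply_apply]
  have t2' : τ (σ m₂) = m₂ := by rw [← t2, hτ.apply_apply]
  have t3' : τ (σ m₃) = m₃ := by rw [← t3, hτ.apply_apply]
  have t0 {p} (hp : p ∉ [p₁, q₁, p₂, q₂, p₃, q₃]) : τ p = p := by
    simp only [List.mem_cons, List.not_mem_nil, or_false, not_or] at hp
    obtain ⟨a, b, c, d, e, f⟩ := hp
    exact hτ.apply_of_ne p a b c d e f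
  have hsymm (p) : τ (σ'.symm p) = σ.symm (τ p) := by
    obtain ⟨q, rfl⟩ := σ'.surjective p
    rw [Equiv.symm_apply_apply, Equiv.eq_symm_apply, hσ', hinv, Equiv.Perm.mul_apply,
      Equiv.Perm.mul_apply, hτ.apply_apply]
  refine ⟨f m₁, f m₂, f m₃, fun v₁ v₂ v₃ => ?_⟩
  let g := Function.update (Function.update (Function.update f m₁ v₁) m₂ v₂) m₃ v₃
  simp only [List.nodup_cons, List.mem_cons, List.not_mem_nil, or_false, not_or, not_false_eq_true,
    List.nodup_nil, and_true] at hm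
  obtain ⟨⟨a1, a2, a3, a4, a5⟩, ⟨b2, b3, b4, b5⟩, ⟨c3, c4, c5⟩, ⟨d4, d5⟩, e5⟩ := hm
  have g1 : g m₁ = v₁ := by simp [g, a2, a4]
  have g2 : g m₂ = v₂ := by simp [g, c4]
  have g3 : g m₃ = v₃ := by simp [g]
  have hg {p} (hp1 : p ≠ m₁) (hp2 : p ≠ m₂) (hp3 : p ≠ m₃) : g p = f p := by simp [g, *]
  have hg' {p} (hp1 : p ≠ σ m₁) (hp2 : p ≠ σ m₂) (hp3 : p ≠ σ m₃) :
      g (σ.symm p) = f (σ.symm p) := by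
    apply hg <;> rwa [ne_eq, Equiv.symm_apply_eq]
  have n1 : g (σ m₁) = f (σ m₁) := hg (Ne.symm a1) b2 b4
  have n2 : g (σ m₂) = f (σ m₂) := hg (Ne.symm a3) (Ne.symm c3) d4
  have n3 : g (σ m₃) = f (σ m₃) := hg (Ne.symm a5) (Ne.symm c5) (Ne.symm e5)
  have o1 : g (σ.symm m₁) = f (σ.symm m₁) := hg' a1 a3 a5
  have o2 : g (σ.symm m₂) = f (σ.symm m₂) := hg' (Ne.symm b2) c3 c5
  have o3 : g (σ.symm m₃) = f (σ.symm m₃) := hg' (Ne.symm b4) (Ne.symm d4) e5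
  have strand {p q m v} (k : m = p ∧ σ m = q ∨ m = q ∧ σ m = p) (t : τ m = σ m)
      (t' : τ (σ m) = m) (gm : g m = v) (n : g (σ m) = f (σ m))
      (o : g (σ.symm m) = f (σ.symm m)) :
      IsExchangedStrand σ σ' f (fun p => g (τ p)) p q (f m) v := by
    rcases k with ⟨rfl, rfl⟩ | ⟨rfl, rfl⟩
    · refine Or.inl ⟨rfl, ?_, ?_, ?_, ?_, ?_⟩ <;>
        simp only [hsymm, t, t', gm, n, o, Equiv.symm_apply_apply]
    · refine Or.inr ⟨rfl, ?_, ?_, ?_, ?_, ?_⟩ <;>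
        simp only [hsymm, t, t', gm, n, o, Equiv.symm_apply_apply]
  refine ⟨fun p => g (τ p), strand k1 t1 t1' g1 n1 o1, strand k2 t2 t2' g2 n2 o2,
    strand k3 t3 t3' g3 n3 o3, fun p hp => ?_, fun u hu hw1 hw2 hw3 p => ?_⟩
  · simp only [hsymm, t0 hp]
    rw [hmem] at hp
    simp only [List.mem_cons, List.not_mem_nil, or_false, not_or] at hp
    exact ⟨hg hp.1 hp.2.2.1 hp.2.2.2.2.1, hg' hp.2.1 hp.2.2.2.1 hp.2.2.2.2.2⟩
  · by_cases hp1 : p = m₁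
    · rw [hp1, hw1]
    by_cases hp2 : p = m₂
    · rw [hp2, hw2]
    by_cases hp3 : p = m₃
    · rw [hp3, hw3]
    · have : g (τ (τ p)) = u := hu (τ p)
      rwa [hτ.apply_apply, hg hp1 hp2 hp3] at this

variable {D : GaussDiagram} {R : Type*} [CommRing R]

/-- The third Reidemeister move. With `w₁` the colour of the strand on top and `w₂`, `w₃` those of
the other two sides of the triangle, the new colours of the sides are determined by the Fox
relations at the crossings of the new triangle. -/
theorem exists_isFoxAt_exchange {C : Type*} {σ τ σ' : Equiv.Perm (C × Bool)} {a b c : C} {o : Bool}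
    (hab : a ≠ b) (hbc : b ≠ c) (hca : c ≠ a)
    (hτ : IsTripleSwap τ (a, true) (b, true) (b, false) (c, o) (c, !o) (a, false))
    (h₁ : Adjacent σ (a, true) (b, true)) (h₂ : Adjacent σ (b, false) (c, o))
    (h₃ : Adjacent σ (c, !o) (a, false)) (hσ' : σ' = τ * σ * τ⁻¹) {f : C × Bool → R}
    (hf : ∀ d, IsFoxAt σ f d) :
    ∃ f' : C × Bool → R, (∀ d, IsFoxAt σ' f' d) ∧ ∀ u, (∀ p, f' p = u) → ∀ p, f p = u := by
  have hnodup : [(a, true), (b, true), (b, false), (c, o), (c, !o), (a, false)].Nodup := by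
    cases o <;> simp [hab, hab.symm, hbc, hca, hca.symm]
  obtain ⟨w₁, w₂, w₃, H⟩ := exists_exchanged_colouring hnodup hτ h₁ h₂ h₃ hσ' f
  have ha := hf a
  have hb := hf b
  have hc := hf c
  unfold IsFoxAt at ha hb hc
  have rest {f' : C × Bool → R} (hf' : ∀ p ∉ [(a, true), (b, true), (b, false), (c, o), (c, !o),
      (a, false)], f' p = f p ∧ f' (σ'.symm p) = f (σ.symm p)) {d : C} (hda : d ≠ a) (hdb : d ≠ b)
      (hdc : d ≠ c) : IsFoxAt σ' f' d := by
    have h (o') := hf' (d, o') (by simp [hda, hdb, hdc])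
    unfold IsFoxAt
    rw [(h true).1, (h true).2, (h false).1, (h false).2]
    exact hf d
  cases o
  · obtain ⟨f', s1, s2, s3, hf', hconst⟩ := H w₁ (2 * w₁ - 2 * w₃ + w₂) (2 * w₁ - w₃)
    have xa := s1.eq_of_eq ha.1
    have xb := s1.symm.eq_of_eq hb.1
    have xc := s3.eq_of_eq hc.1
    have ya := s1.eq_and_eq (by rw [← hb.1, xb])
    have yb := s1.symm.eq_and_eq (by rw [← ha.1, xa])
    have yc := s3.eq_and_eq (by rw [Bool.not_false] at *; linear_combination ha.2 + 2 * xa)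
    simp only [Bool.not_false] at *
    refine ⟨f', fun d => ?_, fun u hu => ?_⟩
    · by_cases hda : d = a
      · subst hda
        refine ⟨ya.1.trans ya.2.symm, ?_⟩
        linear_combination s3.symm.add_eq + 2 * xc - hc.1 - 2 * ya.1
      by_cases hdb : d = b
      · subst hdb
        refine ⟨yb.1.trans yb.2.symm, ?_⟩
        linear_combination s2.add_eq + hc.2 + 2 * xc - 2 * yb.1
      by_cases hdc : d = c
      · subst hdc
        refine ⟨yc.1.trans yc.2.symm, ?_⟩
        linear_combination s2.symm.add_eq + hb.2 + 2 * xb - 2 * yc.1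
      exact rest hf' hda hdb hdc
    · have e1 := s1.eq_of_forall_eq hu
      have e2 := s2.eq_of_forall_eq hu
      have e3 := s3.eq_of_forall_eq hu
      exact hconst u hu e1 (by linear_combination e2 - 2 * e3 + 2 * e1)
        (by linear_combination 2 * e1 - e3)
  · obtain ⟨f', s1, s2, s3, hf', hconst⟩ := H w₁ (2 * w₁ - w₂) (2 * w₁ - 2 * w₂ + w₃)
    have xa := s1.eq_of_eq ha.1
    have xb := s1.symm.eq_of_eq hb.1
    have xc := s2.symm.eq_of_eq hc.1
    have ya := s1.eq_and_eq (by rw [← hb.1, xb])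
    have yb := s1.symm.eq_and_eq (by rw [← ha.1, xa])
    have yc := s2.symm.eq_and_eq (by linear_combination hb.2 + 2 * xb)
    simp only [Bool.not_true] at *
    refine ⟨f', fun d => ?_, fun u hu => ?_⟩
    · by_cases hda : d = a
      · subst hda
        refine ⟨ya.1.trans ya.2.symm, ?_⟩
        linear_combination s3.symm.add_eq + hc.2 + 2 * xc - 2 * ya.1
      by_cases hdb : d = b
      · subst hdb
        refine ⟨yb.1.trans yb.2.symm, ?_⟩
        linear_combination s2.add_eq + 2 * xc - hc.1 - 2 * yb.1
      by_cases hdc : d = c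
      · subst hdc
        refine ⟨yc.1.trans yc.2.symm, ?_⟩
        linear_combination s3.add_eq + ha.2 + 2 * xa - 2 * yc.1
      exact rest hf' hda hdb hdc
    · have e1 := s1.eq_of_forall_eq hu
      have e2 := s2.eq_of_forall_eq hu
      have e3 := s3.eq_of_forall_eq hu
      exact hconst u hu e1 (by linear_combination 2 * e1 - e2)
        (by linear_combination e3 - 2 * e2 + 2 * e1)

/-- The exchange inverts itself, so one direction of the transfer of colourings suffices. -/
theorem foxRigid_of_exchange {D D' : GaussDiagram} {τ : Equiv.Perm (D.Crossing × Bool)}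
    {a b c : D.Crossing} {o : Bool} (hab : a ≠ b) (hbc : b ≠ c) (hca : c ≠ a)
    (hτ : IsTripleSwap τ (a, true) (b, true) (b, false) (c, o) (c, !o) (a, false))
    (h₁ : Adjacent D.next (a, true) (b, true)) (h₂ : Adjacent D.next (b, false) (c, o))
    (h₃ : Adjacent D.next (c, !o) (a, false)) {next' : Equiv.Perm (D.Crossing × Bool)}
    (hnext : next' = τ * D.next * τ⁻¹)
    (hD' : D' = { D with next := next' }) :
    FoxRigid D R ↔ FoxRigid D' R := by
  subst hD'
  have hinv : τ⁻¹ = τ := hτ.inv_eq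
  constructor
  · intro H f g hf
    have hconj (p) : next' (τ p) = τ (D.next p) := by simp [hnext]
    have hadj {p q} (hpq : τ p = q) (h : Adjacent D.next p q) : Adjacent next' p q := by
      have hqp : τ q = p := by rw [← hpq, hτ.apply_apply]
      rcases h with h | h
      · exact Or.inr (by rw [← hpq, hconj, h, hqp])
      · exact Or.inl (by rw [← hqp, hconj, h, hpq])
    obtain ⟨f', hf', h⟩ := exists_isFoxAt_exchange (R := R) (σ' := D.next) hab hbc hca hτ
      (hadj hτ.swap₁ h₁) (hadj hτ.swap₂ h₂) (hadj hτ.swap₃ h₃)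
      (by rw [hnext, hinv]; ext p <;> simp [hτ.apply_apply]) hf
    obtain ⟨u, hu, hu'⟩ := H f' g hf'
    exact ⟨u, h u hu, hu'⟩
  · intro H f g hf
    obtain ⟨f', hf', h⟩ := exists_isFoxAt_exchange (R := R) hab hbc hca hτ h₁ h₂ h₃ hnext hf
    obtain ⟨u, hu, hu'⟩ := H f' g hf'
    exact ⟨u, h u hu, hu'⟩

theorem FoxRigid.of_iso {D D' : GaussDiagram} (h : FoxRigid D R) (e : D.Crossing ≃ D'.Crossing)
    (e' : D.Circle ≃ D'.Circle)
    (hnext : ∀ p, D'.next (Prod.map e id p) = Prod.map e id (D.next p)) : FoxRigid D' R := by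
  intro f g hf
  have hsymm (p) : D'.next.symm (Prod.map e id p) = Prod.map e id (D.next.symm p) := by
    rw [Equiv.symm_apply_eq, hnext, Equiv.apply_symm_apply]
  obtain ⟨u, hu, hu'⟩ := h (fun p => f (Prod.map e id p)) (fun t => g (e' t)) (fun c => by
    have := hf (e c)
    unfold IsFoxAt at this ⊢
    simp only [← hsymm]
    exact this)
  refine ⟨u, fun p => ?_, fun t => ?_⟩
  · simpa using hu (e.symm p.1, p.2)
  · simpa using hu' (e'.symm t)

/-- Rigidity is invariant under the moves; planarity plays no role here. -/
theorem Move.foxRigid_iff {D D' : GaussDiagram} (h : Move D D') :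
    FoxRigid D R ↔ FoxRigid D' R := by
  classical
  cases h with
  | iso _ f e _ hnext =>
    refine ⟨fun h => h.of_iso f e hnext, fun h => h.of_iso f.symm e.symm fun p => ?_⟩
    have hf (q : D.Crossing × Bool) : Prod.map f.symm id (Prod.map f id q) = q :=
      Prod.ext (f.symm_apply_apply q.1) rfl
    have hp : Prod.map f id (Prod.map f.symm id p) = p := Prod.ext (f.apply_symm_apply p.1) rfl
    have := hnext (Prod.map f.symm id p)
    rw [hp] at this
    rw [this, hf]
  | r1 x h => rw [foxRigid_eraseCrossings, foxRigid_of_monogon h]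
  | r2 x h hne hover =>
    rw [foxRigid_eraseCrossings]
    have h1 := adjacent_target x
    have h2 := adjacent_target (D.face x)
    have h3 := target_of_face_eq (y := D.face x) rfl
    rw [target_of_face_eq h] at h2
    obtain ⟨⟨c, o⟩, b⟩ := x
    generalize D.face ((c, o), b) = y at h2 h3
    obtain ⟨⟨d, o'⟩, b'⟩ := y
    rw [h3] at h1 hne hover ⊢
    obtain ⟨rfl, ho⟩ : o = true ∧ (!o') = true := hover
    obtain rfl : o' = false := by simpa using ho
    rcases h2 with h2 | h2
    · rw [Set.pair_comm]
      exact foxRigid_of_bigon hne.symm h2 h1.symm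
    · exact foxRigid_of_bigon hne h2 h1
  | r3 x y z hxy hyz hzx hne hover =>
    have h1 := adjacent_target x
    have h2 := adjacent_target y
    have h3 := adjacent_target z
    have tx := target_of_face_eq hxy
    have ty := target_of_face_eq hyz
    have tz := target_of_face_eq hzx
    rw [tx] at h1 hover
    rw [ty] at h2
    rw [tz] at h3
    have he : ∀ D' : GaussDiagram, D' = { D with
        next := (Equiv.swap x.1 (y.1.1, !y.1.2) * Equiv.swap y.1 (z.1.1, !z.1.2) *
          Equiv.swap z.1 (x.1.1, !x.1.2)) * D.next * (Equiv.swap x.1 (y.1.1, !y.1.2) *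
          Equiv.swap y.1 (z.1.1, !z.1.2) * Equiv.swap z.1 (x.1.1, !x.1.2))⁻¹ } →
        (FoxRigid D R ↔ FoxRigid D' R) := by
      clear hxy hyz hzx tx ty tz
      obtain ⟨⟨a, o₁⟩, b₁⟩ := x
      obtain ⟨⟨b, o₂⟩, b₂⟩ := y
      obtain ⟨⟨c, o₃⟩, b₃⟩ := z
      obtain ⟨rfl, ho⟩ : o₁ = true ∧ (!o₂) = true := hover
      obtain rfl : o₂ = false := by simpa using ho
      obtain ⟨hab, hbc, hca⟩ : a ≠ b ∧ b ≠ c ∧ c ≠ a := hne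
      obtain ⟨o, rfl⟩ : ∃ o, o₃ = !o := ⟨!o₃, by simp⟩
      simp only [Bool.not_not, Bool.not_true, Bool.not_false] at h1 h2 h3 ⊢
      intro D' hD'
      refine foxRigid_of_exchange hab hbc hca (isTripleSwap_swap ?_) h1 h2 h3 rfl hD'
      cases o <;> simp [hab, hab.symm, hbc, hca, hca.symm]
    apply he
    simp only [exchange, tx, ty, tz]

theorem SameLink.foxRigid_iff {D D' : GaussDiagram} (h : SameLink D D') :
    FoxRigid D R ↔ FoxRigid D' R := by
  induction h with
  | rel _ _ h => exact h.2.2.foxRigid_iff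
  | refl => rfl
  | symm _ _ _ ih => exact ih.symm
  | trans _ _ _ _ _ ih ih' => exact ih.trans ih'

theorem foxRigid_unknot : FoxRigid unknot R :=
  fun _ g _ => ⟨g (), fun p => p.1.elim, fun _ => rfl⟩

end GaussDiagram

/-! ### Linear systems and cyclic sums -/

namespace GaussDiagram

/-- An endomorphism of `E → R`, whose image lies in the hyperplane with normal vector `w` and whose
kernel meets the hyperplane `f p₀ = 0` trivially, is onto the hyperplane. -/
theorem exists_apply_eq_of_sum_eq_zero {E R : Type*} [Fintype E] [CommRing R] [Finite R]
    (A : (E → R) →ₗ[R] (E → R)) {w : E → R} {p₀ : E} (hw : IsUnit (w p₀))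
    (hker : ∀ f, A f = 0 → f p₀ = 0 → f = 0) (hA : ∀ f, ∑ p, w p * A f p = 0) {b : E → R}
    (hb : ∑ p, w p * b p = 0) : ∃ f, A f = b := by
  classical
  obtain ⟨a, ha⟩ := hw.exists_right_inv
  -- Adding to `A` a map of rank one transverse to the hyperplane makes it injective.
  let B : (E → R) →ₗ[R] (E → R) :=
    A + (LinearMap.proj (R := R) (φ := fun _ : E => R) p₀).smulRight (Pi.single p₀ a)
  have hB (f) : B f = A f + f p₀ • Pi.single p₀ a := rfl
  have hsum (f) : ∑ p, w p * B f p = f p₀ := by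
    simp only [hB, Pi.add_apply, Pi.smul_apply, smul_eq_mul, mul_add, Finset.sum_add_distrib, hA,
      zero_add]
    rw [Finset.sum_eq_single p₀ (fun p _ hp => by simp [hp]) (by simp), Pi.single_eq_same]
    linear_combination f p₀ * ha
  have hinj : Function.Injective B := by
    rw [injective_iff_map_eq_zero]
    intro f hf
    have h0 : f p₀ = 0 := by rw [← hsum f, hf]; simp
    rw [hB, h0, zero_smul, add_zero] at hf
    exact hker f hf h0
  obtain ⟨f, rfl⟩ := Finite.surjective_of_injective hinj b
  have h0 : f p₀ = 0 := by rw [← hsum f, hb]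
  exact ⟨f, by rw [hB, h0, zero_smul, add_zero]⟩

open Classical in
/-- A function whose sum over each cycle of `σ` vanishes is a difference `s - s ∘ σ⁻¹`. -/
theorem exists_eq_add_of_sum_sameCycle_eq_zero {E A : Type*} [Fintype E] [AddCommGroup A]
    [Finite A] (σ : Equiv.Perm E) (d : E → A)
    (hd : ∀ p, ∑ q with σ.SameCycle p q, d q = 0) :
    ∃ s : E → A, ∀ p, s p = s (σ.symm p) + d p := by
  let rep (p : E) : E := (Quotient.mk (Equiv.Perm.SameCycle.setoid σ) p).out
  have hrep (p) : σ.SameCycle p (rep p) := (Quotient.exact (Quotient.out_eq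
    (Quotient.mk (Equiv.Perm.SameCycle.setoid σ) p))).symm
  have hrep' {p q} (h : σ.SameCycle p q) : rep p = rep q :=
    congrArg Quotient.out (Quotient.sound h)
  -- Adding the value at one chosen point of each cycle makes `s ↦ s - s ∘ σ⁻¹` injective.
  let B : (E → A) →+ (E → A) :=
    { toFun := fun s p => s p - s (σ.symm p) + if p = rep p then s p else 0
      map_zero' := by ext; simp
      map_add' := fun s t => by ext p; simp only [Pi.add_apply]; split_ifs <;> abel }
  have hsum (s p) : ∑ q with σ.SameCycle p q, B s q = s (rep p) := by
    simp only [B, AddMonoidHom.coe_mk, ZeroHom.coe_mk, Finset.sum_add_distrib,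
      Finset.sum_sub_distrib]
    have h1 : ∑ q with σ.SameCycle p q, s (σ.symm q) = ∑ q with σ.SameCycle p q, s q := by
      simp only [Finset.sum_filter]
      rw [← Equiv.sum_comp σ]
      simp [Equiv.Perm.sameCycle_apply_right]
    rw [h1, sub_self, zero_add, Finset.sum_eq_single (rep p)]
    · rw [if_pos (hrep' (hrep p))]
    · intro q hq hne
      rw [if_neg]
      rwa [← hrep' (Finset.mem_filter.mp hq).2]
    · intro h
      exact absurd (Finset.mem_filter.mpr ⟨Finset.mem_univ _, hrep p⟩) h
  have hB {s} (h : ∀ p, s (rep p) = 0) (p) : B s p = s p - s (σ.symm p) := by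
    have : (if p = rep p then s p else 0) = 0 := by
      split_ifs with hp
      · rw [hp, h]
      · rfl
    simp only [B, AddMonoidHom.coe_mk, ZeroHom.coe_mk, this, add_zero]
  have hinj : Function.Injective B := by
    rw [injective_iff_map_eq_zero]
    intro s hs
    have h0 (p) : s (rep p) = 0 := by rw [← hsum s, hs]; simp
    have h1 (p) : s (σ p) = s p := by
      have := hB h0 (σ p)
      rw [hs, Equiv.symm_apply_apply] at this
      exact sub_eq_zero.mp this.symm
    have h2 (n : ℕ) (p) : s ((σ ^ n) p) = s p := by
      induction n with
      | zero => rfl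
      | succ n ih => rw [pow_succ', Equiv.Perm.mul_apply, h1, ih]
    ext p
    obtain ⟨n, -, -, hn⟩ := (hrep p).exists_pow_eq''
    rw [← h2 n, hn, h0, Pi.zero_apply]
  obtain ⟨s, rfl⟩ := Finite.surjective_of_injective hinj d
  have h0 (p) : s (rep p) = 0 := by rw [← hsum s, hd]
  exact ⟨s, fun p => by rw [hB h0]; abel⟩

/-- The sign `(-1)ˣ`. -/
def parity (R : Type*) [CommRing R] (x : ZMod 2) : R := if x = 0 then 1 else -1

variable {R : Type*} [CommRing R]

theorem parity_add (x y : ZMod 2) : parity R (x + y) = parity R x * parity R y := by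
  have h (z : ZMod 2) : z = 0 ∨ z = 1 := by revert z; decide
  have h2 : (1 + 1 : ZMod 2) = 0 := rfl
  rcases h x with rfl | rfl <;> rcases h y with rfl | rfl <;> simp [parity, h2]

theorem parity_add_one (x : ZMod 2) : parity R (x + 1) = -parity R x := by
  rw [parity_add]; simp [parity]

theorem parity_eq (x : ZMod 2) : parity R x = 1 ∨ parity R x = -1 := by
  unfold parity; split_ifs <;> simp

variable {D : GaussDiagram}

open Classical in
/-- If `ℓ₀` has even linking number with the other components, then there are signs on their edges
that change exactly at the passages under `ℓ₀`. -/
theorem exists_rotation_sign {ℓ₀ : D.Component}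
    (hlk : ∀ ℓ : D.Component, ℓ ≠ ℓ₀ → Even (D.linkingNumber ℓ₀ ℓ)) :
    ∃ s : D.Crossing × Bool → ZMod 2, ∀ p, D.componentOf p ≠ ℓ₀ →
      s p = s (D.next.symm p) +
        if p.2 = false ∧ D.componentOf (p.1, true) = ℓ₀ then 1 else 0 := by
  have := Fintype.ofFinite D.Crossing
  let d (p : D.Crossing × Bool) : ZMod 2 := if D.componentOf p ≠ ℓ₀ ∧ p.2 = false ∧
    D.componentOf (p.1, true) = ℓ₀ then 1 else 0
  obtain ⟨s, hs⟩ := exists_eq_add_of_sum_sameCycle_eq_zero D.next d (by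
    intro p
    simp only [← componentOf_eq_iff]
    by_cases hp : D.componentOf p = ℓ₀
    · apply Finset.sum_eq_zero
      intro q hq
      simp [d, ← (Finset.mem_filter.mp hq).2, hp]
    · have h := hlk _ hp
      rw [linkingNumber, finsum_mem_def, finsum_eq_sum_of_fintype] at h
      have h2 := (ZMod.intCast_zmod_eq_zero_iff_dvd _ 2).mpr h.two_dvd
      have hsign (u : ℤˣ) : (((u : ℤˣ) : ℤ) : ZMod 2) = 1 := by
        rcases Int.units_eq_one_or u with rfl | rfl <;> rfl
      rw [← h2, Int.cast_sum, Finset.sum_filter, Fintype.sum_prod_type]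
      refine Finset.sum_congr rfl fun c _ => ?_
      simp only [d, Set.indicator_apply, Fintype.sum_bool, Set.mem_ofPred_eq]
      by_cases h1 : D.componentOf (c, true) = ℓ₀ <;>
        by_cases h3 : D.componentOf (c, false) = D.componentOf p
      all_goals simp [h1, h3, hp, hsign, eq_comm (a := D.componentOf p)])
  exact ⟨s, fun p hp => by rw [hs]; simp [d, hp]⟩

end GaussDiagram

/-! ### The reflections along the trivial component -/

namespace GaussDiagram

variable {D : GaussDiagram} {R : Type*} [CommRing R]

/-- The sum of the increments of a function along one or several components vanishes. -/
theorem sum_increments_eq_zero [Fintype D.Crossing] (P : D.Component → Prop) [DecidablePred P]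
    (h : D.Crossing × Bool → R) :
    ∑ c, ((if P (D.componentOf (c, true)) then h (c, true) - h (D.next.symm (c, true)) else 0) +
      if P (D.componentOf (c, false)) then h (c, false) - h (D.next.symm (c, false)) else 0) =
      0 := by
  have h1 : ∑ p : D.Crossing × Bool, (if P (D.componentOf p) then h (D.next.symm p) else 0) =
      ∑ p : D.Crossing × Bool, if P (D.componentOf p) then h p else 0 := by
    rw [← Equiv.sum_comp D.next]
    simp [componentOf_next]
  have h2 : ∑ p : D.Crossing × Bool,
      (if P (D.componentOf p) then h p - h (D.next.symm p) else 0) = 0 := by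
    have h3 (p) : (if P (D.componentOf p) then h p - h (D.next.symm p) else 0) =
        (if P (D.componentOf p) then h p else 0) -
          if P (D.componentOf p) then h (D.next.symm p) else 0 := by
      split_ifs <;> simp
    rw [Finset.sum_congr rfl fun p _ => h3 p, Finset.sum_sub_distrib, h1, sub_self]
  rw [Fintype.sum_prod_type] at h2
  simpa only [Fintype.sum_bool] using h2

open Classical in
/-- The reflections along the trivial component `ℓ₀`: given rotations `s` on the other components,
the Fox relations with the inhomogeneous terms at the passages of `ℓ₀` under the other components
have a solution. -/
theorem exists_reflections [Finite R] (hD : D.Planar) (ℓ₀ : D.Component)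
    (hrigid : FoxRigid (D.sublink {ℓ₀}) R) {s : D.Crossing × Bool → ZMod 2}
    (hs : ∀ p, D.componentOf p ≠ ℓ₀ → s p = s (D.next.symm p) +
      if p.2 = false ∧ D.componentOf (p.1, true) = ℓ₀ then 1 else 0) :
    ∃ f : D.Crossing × Bool → R, ∀ c,
      (D.componentOf (c, true) = ℓ₀ → f (c, true) = f (D.next.symm (c, true))) ∧
      (D.componentOf (c, false) = ℓ₀ → D.componentOf (c, true) = ℓ₀ →
        f (c, false) + f (D.next.symm (c, false)) = 2 * f (c, true)) ∧
      (D.componentOf (c, false) = ℓ₀ → D.componentOf (c, true) ≠ ℓ₀ →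
        f (c, false) = f (D.next.symm (c, false)) +
          2 * ((D.sign c : ℤ) : R) * parity R (s (c, true))) := by
  by_cases hex : ∃ p₀, D.componentOf p₀ = ℓ₀
  swap
  · push Not at hex
    exact ⟨0, fun c => ⟨fun h => absurd h (hex _), fun h => absurd h (hex _),
      fun h => absurd h (hex _)⟩⟩
  obtain ⟨p₀, hp₀⟩ := hex
  have := Fintype.ofFinite D.Crossing
  obtain ⟨L, hL⟩ := exists_checkerboard hD (fun p => if D.componentOf p = ℓ₀ then 1 else 0)
    (fun p => by simp only [componentOf_next_symm])
  -- One equation for each passage of `ℓ₀`; off `ℓ₀` the map is the identity.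
  let A : (D.Crossing × Bool → R) →ₗ[R] (D.Crossing × Bool → R) :=
    { toFun := fun f p => if D.componentOf p = ℓ₀ then
        if p.2 = false ∧ D.componentOf (p.1, true) = ℓ₀ then
          f p + f (D.next.symm p) - 2 * f (p.1, true)
        else f p - f (D.next.symm p)
        else f p
      map_add' := fun f g => by
        ext p; simp only [Pi.add_apply]; split_ifs <;> ring
      map_smul' := fun a f => by
        ext p; simp only [Pi.smul_apply, smul_eq_mul, RingHom.id_apply]; split_ifs <;> ring }
  have hA (f p) : A f p = if D.componentOf p = ℓ₀ then
        if p.2 = false ∧ D.componentOf (p.1, true) = ℓ₀ then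
          f p + f (D.next.symm p) - 2 * f (p.1, true)
        else f p - f (D.next.symm p)
        else f p := rfl
  -- The opposite sign at over-passages of self-crossings moves the term `2 * f (c, true)` of the
  -- increment there to the Fox relation of the under-passage.
  let w (p : D.Crossing × Bool) : R := if D.componentOf p = ℓ₀ then
    if p.2 = true ∧ D.componentOf (p.1, false) = ℓ₀ then -parity R (L p) else parity R (L p) else 0
  let b (p : D.Crossing × Bool) : R := if p.2 = false ∧ D.componentOf p = ℓ₀ ∧
    D.componentOf (p.1, true) ≠ ℓ₀ then 2 * ((D.sign p.1 : ℤ) : R) * parity R (s (p.1, true)) else 0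
  have hsign (c) : D.sign c = 1 ∨ D.sign c = -1 := Int.units_eq_one_or _
  have hw : IsUnit (w p₀) := by
    simp only [w, hp₀, if_true]
    rcases parity_eq (R := R) (L p₀) with h | h <;> split_ifs <;> simp [h]
  have hker (f) (hf : A f = 0) (h0 : f p₀ = 0) : f = 0 := by
    have hf' (p) : A f p = 0 := congrFun hf p
    simp only [hA] at hf'
    obtain ⟨u, hu, -⟩ := hrigid.of_restrict (K := {ℓ₀})
      (S := {c | ∀ o : Bool, D.componentOf (c, o) ∈ ({ℓ₀} : Set D.Component)})
      (fun c hc o => hc o) f 0 (fun c hc => by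
      have h1 := hf' (c, true)
      have h2 := hf' (c, false)
      have h3 : D.componentOf (c, true) = ℓ₀ := hc true
      have h4 : D.componentOf (c, false) = ℓ₀ := hc false
      simp only [h3, h4, if_true, Bool.true_eq_false, false_and, if_false, and_self] at h1 h2
      exact ⟨sub_eq_zero.mp h1, sub_eq_zero.mp h2⟩) (by
      rintro ⟨c, o⟩ hc hp
      have h1 := hf' (c, o)
      have h2 : D.componentOf (c, o) = ℓ₀ := hp
      rw [if_pos h2, if_neg, sub_eq_zero] at h1
      · exact h1
      · rintro ⟨ho, h3⟩
        obtain rfl : o = false := ho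
        exact hc (by rintro (_ | _) <;> assumption))
    have hu0 : u = 0 := by rw [← hu p₀ hp₀, h0]
    ext p
    by_cases hp : D.componentOf p = ℓ₀
    · rw [hu p hp, hu0, Pi.zero_apply]
    · have := hf' p
      rwa [if_neg hp] at this
  have hwA (f) : ∑ p, w p * A f p = 0 := by
    rw [← sum_increments_eq_zero (· = ℓ₀) (fun p => parity R (L p) * f p), Fintype.sum_prod_type]
    refine Finset.sum_congr rfl fun c _ => ?_
    obtain ⟨h1, h2, h3⟩ := hL c
    have ht := h1 true
    have hf := h1 false
    simp only [Fintype.sum_bool, hA, w]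
    by_cases ho : D.componentOf (c, true) = ℓ₀ <;> by_cases hu : D.componentOf (c, false) = ℓ₀ <;>
      simp only [ho, hu, Bool.not_true, Bool.not_false, if_true, if_false, add_zero,
        Bool.true_eq_false, Bool.false_eq_true, true_and, false_and, and_self] at ht hf h2 h3 ⊢
    -- The left sides of the two strands of a self-crossing have opposite classes.
    · have key : parity R (L (c, false)) = -parity R (L (c, true)) := by
        rcases hsign c with h | h
        · rw [h2 h, parity_add_one]
        · rw [h3 h, parity_add_one, neg_neg]
      have ht' := congrArg (parity R) ht
      have hf' := congrArg (parity R) hf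
      rw [parity_add_one] at ht' hf'
      linear_combination f (D.next.symm (c, true)) * ht' + f (D.next.symm (c, false)) * hf' -
        2 * f (c, true) * key
    · rw [ht]; ring
    · rw [hf]; ring
    · ring
  have hwb : ∑ p, w p * b p = 0 := by
    rw [← neg_eq_zero, ← sum_increments_eq_zero (· ≠ ℓ₀) (fun p => parity R (L p + s p)),
      Fintype.sum_prod_type, ← Finset.sum_neg_distrib]
    refine Finset.sum_congr rfl fun c _ => ?_
    obtain ⟨h1, h2, h3⟩ := hL c
    have ht := h1 true
    have hf := h1 false
    have hst := hs (c, true)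
    have hsf := hs (c, false)
    simp only [Fintype.sum_bool, b, w]
    by_cases ho : D.componentOf (c, true) = ℓ₀ <;> by_cases hu : D.componentOf (c, false) = ℓ₀ <;>
      simp only [ho, hu, Bool.not_true, Bool.not_false, if_true, if_false, add_zero, parity_add,
        Bool.true_eq_false, Bool.false_eq_true, and_self, not_true, not_false_iff, ne_eq,
        true_implies, mul_zero, and_true, and_false] at ht hf h2 h3 hst hsf ⊢
    · ring
    · rw [hsf, hf, parity_add_one, parity_add_one]; ring
    -- The over strand leaves on the right of `ℓ₀` at a positive crossing and on its left at a
    -- negative one.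
    · have key : parity R (L (c, false)) * ((D.sign c : ℤ) : R) = -parity R (L (c, true)) := by
        rcases hsign c with h | h
        · rw [h2 h, parity_add_one, h]; simp
        · rw [h3 h, h]; simp
      have key2 := congrArg (parity R) ht
      rw [parity_add_one] at key2
      rw [← hst]
      linear_combination (-2 * parity R (s (c, true))) * key + parity R (s (c, true)) * key2
    · rw [hsf, hf, hst, ht]; ring
  obtain ⟨f, hf⟩ := exists_apply_eq_of_sum_eq_zero A hw hker hwA hwb
  have hf' (p) : A f p = b p := congrFun hf p
  simp only [hA, b] at hf'
  refine ⟨f, fun c => ⟨fun ho => ?_, fun hu ho => ?_, fun hu ho => ?_⟩⟩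
  · have := hf' (c, true)
    simp only [ho, if_true, Bool.true_eq_false, false_and, if_false] at this
    exact sub_eq_zero.mp this
  · have := hf' (c, false)
    simp only [ho, hu, if_true, and_self, ne_eq, not_true, and_false, if_false] at this
    exact sub_eq_zero.mp this
  · have := hf' (c, false)
    simp only [ho, hu, if_true, and_false, if_false, ne_eq, not_false_iff, and_self] at this
    exact sub_eq_iff_eq_add'.mp this

end GaussDiagram

/-! ### The dihedral colouring -/

theorem proposition1p5 (D : GaussDiagram) (hD : D.Planar) (ℓ₀ : D.Component)
    (htrivial : D.IsTrivialComponent ℓ₀) (hother : ∃ ℓ : D.Component, ℓ ≠ ℓ₀)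
    (hlk : ∀ ℓ : D.Component, ℓ ≠ ℓ₀ → Even (D.linkingNumber ℓ₀ ℓ))
    (n : ℕ) (hodd : Odd n) (hn : 3 ≤ n) :
    ∃ Γ : D.Arc → DihedralGroup n, D.IsColoring Γ ∧ GaussDiagram.IsTwoTone Γ ∧
      (∀ α : D.Arc, α.component = ℓ₀ → Γ α ∈ GaussDiagram.reflections n) ∧
      (∀ α : D.Arc, α.component ≠ ℓ₀ → Γ α ∈ GaussDiagram.rotations n) := by
  classical
  have : NeZero n := ⟨by omega⟩
  have : Fact (1 < n) := ⟨by omega⟩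
  have hrigid : (D.sublink {ℓ₀}).FoxRigid (ZMod n) :=
    htrivial.foxRigid_iff.mpr GaussDiagram.foxRigid_unknot
  obtain ⟨s, hs⟩ := GaussDiagram.exists_rotation_sign hlk
  obtain ⟨f, hf⟩ := GaussDiagram.exists_reflections hD ℓ₀ hrigid hs
  have hne (x : ZMod 2) : GaussDiagram.parity (ZMod n) x ≠ 0 := by
    rcases GaussDiagram.parity_eq (R := ZMod n) x with h | h <;> simp [h]
  let γ (p : D.Crossing × Bool) : DihedralGroup n := if D.componentOf p = ℓ₀ then
    DihedralGroup.sr (f p) else DihedralGroup.r (GaussDiagram.parity (ZMod n) (s p))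
  have hγ (p) : γ p = if D.componentOf p = ℓ₀ then
    DihedralGroup.sr (f p) else DihedralGroup.r (GaussDiagram.parity (ZMod n) (s p)) := rfl
  have hover (c : D.Crossing) : γ (c, true) = γ (D.next.symm (c, true)) := by
    simp only [hγ, GaussDiagram.componentOf_next_symm]
    split_ifs with h
    · rw [(hf c).1 h]
    · rw [hs _ h, if_neg (by simp), add_zero]
  let Γ : D.Arc → DihedralGroup n := Sum.elim
    (Quot.lift γ (by
      rintro p ⟨c, o⟩ ⟨h, ho⟩
      obtain rfl : o = true := ho
      rw [hover, ← h, Equiv.symm_apply_apply]))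
    (fun t => if Sum.inr t = ℓ₀ then DihedralGroup.sr 0 else DihedralGroup.r 1)
  have hrefl : ∀ α : D.Arc, α.component = ℓ₀ → Γ α ∈ GaussDiagram.reflections n := by
    rintro (α | t) h
    · induction α using Quot.inductionOn with | _ p
      have h' : D.componentOf p = ℓ₀ := h
      exact ⟨f p, by simp [Γ, hγ, h']⟩
    · have h' : Sum.inr t = ℓ₀ := h
      exact ⟨0, by simp [Γ, h']⟩
  have hrot : ∀ α : D.Arc, α.component ≠ ℓ₀ → Γ α ∈ GaussDiagram.rotations n := by
    rintro (α | t) h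
    · induction α using Quot.inductionOn with | _ p
      have h' : D.componentOf p ≠ ℓ₀ := h
      exact ⟨_, hne (s p), by simp [Γ, hγ, h']⟩
    · have h' : Sum.inr t ≠ ℓ₀ := h
      exact ⟨1, one_ne_zero, by simp [Γ, h']⟩
  have harc (ℓ : D.Component) : ∃ α : D.Arc, α.component = ℓ := by
    rcases ℓ with ℓ | t
    · induction ℓ using Quotient.inductionOn with | _ p
      exact ⟨D.arcAfter p, rfl⟩
    · exact ⟨Sum.inr t, rfl⟩
  refine ⟨Γ, fun c => ?_, ⟨?_, ?_, ?_⟩, hrefl, hrot⟩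
  · change (_ → γ (c, true) * γ (c, false) = γ (D.next.symm (c, false)) * γ (c, true)) ∧
      (_ → γ (c, false) * γ (c, true) = γ (c, true) * γ (D.next.symm (c, false)))
    obtain ⟨-, h2, h3⟩ := hf c
    have h4 := hs (c, false)
    simp only [hγ, GaussDiagram.componentOf_next_symm]
    by_cases ho : D.componentOf (c, true) = ℓ₀ <;> by_cases hu : D.componentOf (c, false) = ℓ₀ <;>
      simp only [ho, hu, if_true, if_false, DihedralGroup.sr_mul_sr, DihedralGroup.sr_mul_r,
        DihedralGroup.r_mul_sr, DihedralGroup.r_mul_r, DihedralGroup.r.injEq,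
        DihedralGroup.sr.injEq]
    · have := h2 hu ho
      exact ⟨fun _ => by linear_combination this, fun _ => by linear_combination -this⟩
    · have := h4 hu
      rw [if_pos ⟨rfl, ho⟩] at this
      rw [this, GaussDiagram.parity_add_one]
      exact ⟨fun _ => by ring, fun _ => by ring⟩
    · have := h3 hu ho
      refine ⟨fun h => ?_, fun h => ?_⟩ <;> rw [h] at this <;> push_cast at this <;>
        linear_combination this
    · have := h4 hu
      rw [if_neg (by simp [ho]), add_zero] at this
      rw [this]
      exact ⟨fun _ => by ring, fun _ => by ring⟩
  · rintro ⟨α, hα⟩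
    by_cases h : α.component = ℓ₀
    · obtain ⟨i, hi⟩ := hrefl α h
      rw [hα, DihedralGroup.one_def] at hi
      cases hi
    · obtain ⟨j, hj, hj'⟩ := hrot α h
      rw [hα, DihedralGroup.one_def, DihedralGroup.r.injEq] at hj'
      exact hj hj'
  · obtain ⟨α, hα⟩ := harc ℓ₀
    exact ⟨Γ α, ⟨α, rfl⟩, hrefl α hα⟩
  · obtain ⟨ℓ, hℓ⟩ := hother
    obtain ⟨α, hα⟩ := harc ℓ
    exact ⟨Γ α, ⟨α, rfl⟩, hrot α (hα ▸ hℓ)⟩
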